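/- Let $q\ge 2$ and let $X$ be a $q$-homogeneous tree, i.e. a connected graph without cycles in which every vertex has exactly $q+1$ neighbours. Fix an origin $o\in X$ and write $|x|=d(o,x)$ for the graph distance from $o$. For $\alpha>1$ let $\mu_\alpha$ be the measure on $X$ with density $q^{-\alpha|x|}$ with respect to the counting measure, and let $L^p_\alpha=L^p(X,\mu_\alpha)$ (complex-valued functions). A function $f\colon X\to\mathbb{C}$ is harmonic if $f(v)=\frac1{q+1}\sum_{u\sim v}f(u)$ for every $v\in X$. For $c>1$ let $\mathcal A^2_c$ be the closed subspace of $L^2_c$ consisting of the harmonic functions; point evaluations are bounded on it, and $K_c\colon X\times X\to\mathbb{C}$ denotes its reproducing kernel: $K_c(z,\cdot)\in\mathcal A^2_c$ and $g(z)=\langle g,K_c(z,\cdot)\rangle_{L^2_c}$ for all $g\in\mathcal A^2_c$, $z\in X$. For $a,b\in\mathbb{R}$ and $c>1$ consider the integral operators $$S_{a,b,c}f(z)=q^{-a|z|}\sum_{x\in X}|K_c(z,x)|\,f(x)\,q^{-b|x|},\qquad T_{a,b,c}f(z)=q^{-a|z|}\sum_{x\in X}K_c(z,x)\,f(x)\,q^{-b|x|}.$$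 Such an operator is called bounded on $L^p_\alpha$ if for every $f\in L^p_\alpha$ the series defining it converges absolutely at every $z\in X$, and the operator maps $L^p_\alpha$ into itself with finite operator norm. **Theorem.** Let $\alpha>1$, $c>1$, $1<p<\infty$ and $a,b\in\mathbb{R}$. The following conditions are equivalent: 1. the operator $S_{a,b,c}$ is bounded on $L^p_\alpha$; 2. the operator $T_{a,b,c}$ is bounded on $L^p_\alpha$; 3. $c\le a+b$ and $-pa<\alpha-1<p(b-1)$. -/

import Mathlib

open MeasureTheory
open scoped ENNReal NNReal

noncomputable section

namespace HarmonicBergman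

/-- `q ^ (-s |x|)`, where `|x| = d(o, x)` is the distance from the origin `o`. -/
def weight {V : Type*} (X : SimpleGraph V) (q : ℕ) (o : V) (s : ℝ) (x : V) : ℝ :=
  (q : ℝ) ^ (-s * (X.dist o x : ℝ))

theorem weight_pos {V : Type*} (X : SimpleGraph V) (q : ℕ) [q.AtLeastTwo] (o : V) (s : ℝ)
    (x : V) : 0 < weight X q o s x := by
  have h : 0 < q := lt_of_lt_of_le (by norm_num) (Nat.AtLeastTwo.prop (n := q))
  exact Real.rpow_pos_of_pos (by exact_mod_cast h) _

/-- The measure `μ_α` on the vertices, with density `q ^ (-α |x|)` with respect to the counting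
measure. -/
def expMeasure {V : Type*} [MeasurableSpace V] (X : SimpleGraph V) (q : ℕ) (o : V) (α : ℝ) :
    Measure V :=
  Measure.count.withDensity fun x => ENNReal.ofReal (weight X q o α x)

theorem expMeasure_singleton {V : Type*} [MeasurableSpace V] [DiscreteMeasurableSpace V]
    (X : SimpleGraph V) (q : ℕ) (o : V) (α : ℝ) (x : V) :
    expMeasure X q o α {x} = ENNReal.ofReal (weight X q o α x) := by
  rw [expMeasure, withDensity_apply _ (measurableSet_singleton x), lintegral_singleton]
  simp

/-- Harmonic functions on a graph all of whose vertices have `q + 1` neighbours. -/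
def IsHarmonic {V : Type*} (X : SimpleGraph V) [X.LocallyFinite] (q : ℕ) (f : V → ℂ) : Prop :=
  ∀ v, f v = 1 / ((q : ℂ) + 1) * ∑ u ∈ X.neighborFinset v, f u

section Evaluation

variable {V : Type*} [MeasurableSpace V] [DiscreteMeasurableSpace V] (X : SimpleGraph V)
  (q : ℕ) [q.AtLeastTwo] (o : V) (α : ℝ)

theorem expMeasure_singleton_pos (x : V) : 0 < expMeasure X q o α {x} := by
  rw [expMeasure_singleton]
  exact ENNReal.ofReal_pos.2 (weight_pos X q o α x)

/-- Every vertex has positive mass, so that a property that holds almost everywhere holds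
everywhere; in particular the elements of `L²_α` are genuine functions. -/
theorem forall_of_ae {P : V → Prop} (h : ∀ᵐ x ∂(expMeasure X q o α), P x) (x : V) : P x := by
  by_contra hx
  have h0 : expMeasure X q o α {x} ≤ 0 := by
    rw [← ae_iff.1 h]
    exact measure_mono (by rintro y rfl; exact hx)
  exact absurd h0 (not_le.2 (expMeasure_singleton_pos X q o α x))

theorem norm_apply_le (f : Lp ℂ 2 (expMeasure X q o α)) (x : V) :
    ‖f x‖ ≤ (weight X q o α x) ^ (-(1 / 2 : ℝ)) * ‖f‖ := by
  have hw := weight_pos X q o α x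
  have h1 : eLpNorm f 2 ((expMeasure X q o α).restrict {x}) ≤
      eLpNorm f 2 (expMeasure X q o α) := eLpNorm_restrict_le _ _ _ _
  rw [Measure.restrict_singleton, expMeasure_singleton,
    eLpNorm_smul_measure_of_ne_top (by norm_num),
    eLpNorm_dirac _ _ (by norm_num)] at h1
  have h2 := ENNReal.toReal_mono (Lp.eLpNorm_ne_top f) h1
  rw [← Lp.norm_def] at h2
  simp only [smul_eq_mul, ENNReal.toReal_mul, toReal_enorm, ← ENNReal.toReal_rpow,
    ENNReal.toReal_ofReal hw.le] at h2
  norm_num at h2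
  rw [Real.rpow_neg hw.le]
  rw [← div_eq_inv_mul, le_div_iff₀ (Real.rpow_pos_of_pos hw _), mul_comm]
  exact h2

/-- Point evaluation on `L²_α`, as a bounded functional. -/
def evalLp (x : V) : Lp ℂ 2 (expMeasure X q o α) →L[ℂ] ℂ :=
  LinearMap.mkContinuous
    { toFun := fun f => f x
      map_add' := fun f g => forall_of_ae X q o α (Lp.coeFn_add f g) x
      map_smul' := fun r f => forall_of_ae X q o α (Lp.coeFn_smul r f) x }
    _ fun f => norm_apply_le X q o α f x

@[simp]
theorem evalLp_apply (x : V) (f : Lp ℂ 2 (expMeasure X q o α)) : evalLp X q o α x f = f x := rfl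

end Evaluation

section Kernel

variable {V : Type*} [MeasurableSpace V] [DiscreteMeasurableSpace V] (X : SimpleGraph V)
  [X.LocallyFinite] (q : ℕ) [q.AtLeastTwo] (o : V) (α : ℝ)

/-- The harmonic Bergman space `A²_α`: the harmonic functions in `L²_α`, with the norm and the
inner product of `L²_α`. -/
def bergmanSpace : Submodule ℂ (Lp ℂ 2 (expMeasure X q o α)) where
  carrier := {f | IsHarmonic X q f}
  add_mem' := by
    intro f g hf hg v
    have h := fun u => forall_of_ae X q o α (Lp.coeFn_add f g) u
    simp only [h, Pi.add_apply, Finset.sum_add_distrib, mul_add]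
    rw [← hf v, ← hg v]
  zero_mem' := by
    intro v
    have h := fun u => forall_of_ae X q o α (Lp.coeFn_zero ℂ 2 (expMeasure X q o α)) u
    change (0 : Lp ℂ 2 (expMeasure X q o α)) v = 1 / ((q : ℂ) + 1) *
      ∑ u ∈ X.neighborFinset v, (0 : Lp ℂ 2 (expMeasure X q o α)) u
    simp only [h, Pi.zero_apply, Finset.sum_const_zero, mul_zero]
  smul_mem' := by
    intro r f hf v
    have h := fun u => forall_of_ae X q o α (Lp.coeFn_smul r f) u
    simp only [h, Pi.smul_apply, smul_eq_mul, ← Finset.mul_sum]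
    rw [mul_left_comm, ← hf v]

theorem mem_bergmanSpace (f : Lp ℂ 2 (expMeasure X q o α)) :
    f ∈ bergmanSpace X q o α ↔ IsHarmonic X q f := Iff.rfl

theorem isClosed_bergmanSpace :
    IsClosed (bergmanSpace X q o α : Set (Lp ℂ 2 (expMeasure X q o α))) := by
  have h : (bergmanSpace X q o α : Set (Lp ℂ 2 (expMeasure X q o α))) =
      ⋂ v, {f | evalLp X q o α v f =
        1 / ((q : ℂ) + 1) * ∑ u ∈ X.neighborFinset v, evalLp X q o α u f} := by
    ext f
    simp [mem_bergmanSpace, IsHarmonic]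
  rw [h]
  exact isClosed_iInter fun v => isClosed_eq (by fun_prop) (by fun_prop)

instance completeSpace_bergmanSpace : CompleteSpace (bergmanSpace X q o α) :=
  (isClosed_bergmanSpace X q o α).completeSpace_coe

/-- `A²_α` is a reproducing kernel Hilbert space of functions on the vertices. -/
instance rkhs_bergmanSpace : RKHS ℂ (bergmanSpace X q o α) V ℂ where
  coeCLM := ContinuousLinearMap.pi fun x =>
    (evalLp X q o α x).comp (bergmanSpace X q o α).subtypeL
  coeCLM_injective := by
    intro f g h
    refine Subtype.ext (Lp.ext (Filter.Eventually.of_forall fun x => ?_))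
    exact congrFun h x

/-- The reproducing kernel `K_α(z, x) = K_{α,z}(x)` of `A²_α`, where `K_{α,z} ∈ A²_α` is
characterized by `⟨g, K_{α,z}⟩ = g(z)` for all `g ∈ A²_α`. -/
def bergmanKernel (z x : V) : ℂ := RKHS.kernel (bergmanSpace X q o α) x z 1

end Kernel

section Operators

variable {V : Type*} (X : SimpleGraph V) (q : ℕ) (o : V)

/-- The integral operator
`f ↦ (z ↦ q ^ (-a |z|) ∑ₓ k(z, x) f(x) q ^ (-b |x|))` with kernel `k`. -/
def weightedOp (k : V → V → ℂ) (a b : ℝ) (f : V → ℂ) (z : V) : ℂ :=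
  (weight X q o a z : ℂ) * ∑' x, k z x * f x * (weight X q o b x : ℂ)

/-- The operator `weightedOp k a b` is bounded on `L^p_α`: on every `f ∈ L^p_α` it is given by
(absolutely) convergent series, it maps `L^p_α` to `L^p_α`, and its norm is finite. -/
def IsBoundedOnLp [MeasurableSpace V] (α p : ℝ) (k : V → V → ℂ) (a b : ℝ) : Prop :=
  ∃ C : ℝ≥0, ∀ f : V → ℂ, MemLp f (ENNReal.ofReal p) (expMeasure X q o α) →
    (∀ z, Summable fun x => k z x * f x * (weight X q o b x : ℂ)) ∧
    MemLp (weightedOp X q o k a b f) (ENNReal.ofReal p) (expMeasure X q o α) ∧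
    eLpNorm (weightedOp X q o k a b f) (ENNReal.ofReal p) (expMeasure X q o α) ≤
      C * eLpNorm f (ENNReal.ofReal p) (expMeasure X q o α)

variable [MeasurableSpace V] [DiscreteMeasurableSpace V] [X.LocallyFinite] [q.AtLeastTwo]

/-- `S_{a,b,c}`, with kernel `|K_c|`, is bounded on `L^p_α`. -/
def SIsBounded (α p a b c : ℝ) : Prop :=
  IsBoundedOnLp X q o α p (fun z x => (‖bergmanKernel X q o c z x‖ : ℂ)) a b

/-- `T_{a,b,c}`, with kernel `K_c`, is bounded on `L^p_α`. -/
def TIsBounded (α p a b c : ℝ) : Prop :=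
  IsBoundedOnLp X q o α p (fun z x => bergmanKernel X q o c z x) a b

end Operators

end HarmonicBergman

end

/-! Root the tree at `o`. A harmonic function is a flow: its increments from a vertex to the
children add up to the increment arriving from the parent. Hence its sum over a generation of a
branch depends only on the values at the top vertex and at the parent of that vertex
(`IsHarmonic.sum_desc`). So there are explicit harmonic functions `sectorDev u`, supported below the
parent `v` of `u`, whose pairing with a harmonic `g` in the weight `q^(-c|x|)` gives the increment
of `g` at `u` minus the mean share of the increment at `v`. Adding them along the path from `o` to
`z` builds the reproducing kernel recursively (`exists_isKernelPair`). The construction shows that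
the kernel is real, that its modulus is at most a constant times the sum of `q^(c|y|)` over the
common ancestors `y` of `z` and `x`, that it is at least a constant times `q^(c|x|)` on the
diagonal, and that it is a positive constant when one variable is `o`.

Sufficiency: if `c ≤ a + b`, the weighted kernel is dominated by the sum of `q^(-a(|z|-|y|))
q^(-b(|x|-|y|))` over common ancestors. Schur's test with `q^(s|x|)` reduces its boundedness to
geometric series, and an admissible `s` exists because of the two strict inequalities together with
`1 < c ≤ a + b`.

Necessity uses three tests that involve only the modulus of the kernel, so the cancellations in `T`
do not matter. Point masses evaluated at their own vertex give `c ≤ a + b`; the image of the point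
mass at `o` must be in `L^p`, which gives `-pa < α - 1`; convergence of the series at `z = o` gives
`α - 1 < p(b - 1)`. The step from `S` to `T` is domination. -/

/-- A rooted tree in which the root has `q + 1` children and every other vertex has `q`. The parent
of the root is the root itself. -/
structure RegularRootedTree (V : Type*) (q : ℕ) where
  root : V
  parent : V → V
  level : V → ℕ
  children : V → Finset V
  parent_root : parent root = root
  level_eq_zero : ∀ x, level x = 0 ↔ x = root
  level_parent : ∀ x, x ≠ root → level x = level (parent x) + 1
  mem_children : ∀ x y, y ∈ children x ↔ y ≠ root ∧ parent y = x
  card_children_root : (children root).card = q + 1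
  card_children : ∀ x, x ≠ root → (children x).card = q

/-! ### Generations, branches and sums over them -/

namespace RegularRootedTree

variable {V : Type*} {q : ℕ} (T : RegularRootedTree V q)

theorem level_root : T.level T.root = 0 := (T.level_eq_zero _).2 rfl

theorem induction {P : V → Prop} (root : P T.root)
    (step : ∀ z, z ≠ T.root → P (T.parent z) → P z) (z : V) : P z := by
  induction h : T.level z generalizing z with
  | zero => rwa [(T.level_eq_zero z).1 h]
  | succ n ih =>
    have hz : z ≠ T.root := by rintro rfl; simp [level_root] at h
    exact step z hz (ih _ (by have := T.level_parent z hz; omega))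

theorem level_child {x y : V} (h : y ∈ T.children x) : T.level y = T.level x + 1 := by
  obtain ⟨h1, rfl⟩ := (T.mem_children x y).1 h
  exact T.level_parent y h1

theorem ne_root_of_mem_children {x y : V} (h : y ∈ T.children x) : y ≠ T.root :=
  ((T.mem_children x y).1 h).1

theorem parent_of_mem_children {x y : V} (h : y ∈ T.children x) : T.parent y = x :=
  ((T.mem_children x y).1 h).2

theorem level_iterate_parent (k : ℕ) (x : V) : T.level (T.parent^[k] x) = T.level x - k := by
  induction k with
  | zero => simp
  | succ k ih =>
    rw [Function.iterate_succ_apply']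
    by_cases h : T.parent^[k] x = T.root
    · rw [h, T.level_root] at ih
      rw [h, T.parent_root, T.level_root]
      omega
    · have := T.level_parent _ h
      omega

/-- The descendants of `u` in the `k`-th generation. -/
noncomputable def desc : ℕ → V → Finset V
  | 0, u => {u}
  | k + 1, u => by classical exact (T.children u).biUnion (desc k)

theorem mem_desc (k : ℕ) (u x : V) :
    x ∈ T.desc k u ↔ T.level x = T.level u + k ∧ T.parent^[k] x = u := by
  induction k generalizing u with
  | zero =>
    simp only [desc, Finset.mem_singleton, add_zero, Function.iterate_zero, id_eq]
    exact ⟨by rintro rfl; simp, fun h => h.2⟩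
  | succ k ih =>
    simp only [desc, Finset.mem_biUnion, ih, Function.iterate_succ_apply']
    constructor
    · rintro ⟨c, hc, h1, rfl⟩
      exact ⟨by have := T.level_child hc; omega, T.parent_of_mem_children hc⟩
    · rintro ⟨h1, h2⟩
      have h3 := T.level_iterate_parent k x
      refine ⟨T.parent^[k] x, (T.mem_children _ _).2 ⟨?_, h2⟩, by omega, rfl⟩
      intro h
      rw [h, T.level_root] at h3
      omega

theorem level_of_mem_desc {k : ℕ} {u x : V} (h : x ∈ T.desc k u) : T.level x = T.level u + k :=
  ((T.mem_desc k u x).1 h).1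

theorem sum_desc_succ {E : Type*} [AddCommMonoid E] (k : ℕ) (u : V) (f : V → E) :
    ∑ x ∈ T.desc (k + 1) u, f x = ∑ c ∈ T.children u, ∑ x ∈ T.desc k c, f x := by
  classical
  have h : T.desc (k + 1) u = (T.children u).biUnion (T.desc k) := by simp only [desc]
  rw [h, Finset.sum_biUnion]
  intro c _ c' _ hne
  refine Finset.disjoint_left.2 fun x hx hx' => hne ?_
  rw [← ((T.mem_desc _ _ _).1 hx).2, ((T.mem_desc _ _ _).1 hx').2]

theorem card_desc {u : V} (hu : u ≠ T.root) (k : ℕ) : (T.desc k u).card = q ^ k := by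
  induction k generalizing u with
  | zero => simp [desc]
  | succ k ih =>
    rw [Finset.card_eq_sum_ones, sum_desc_succ]
    simp only [← Finset.card_eq_sum_ones]
    rw [Finset.sum_congr rfl fun c hc => ih (T.ne_root_of_mem_children hc), Finset.sum_const,
      T.card_children u hu, smul_eq_mul, pow_succ, mul_comm]

theorem card_desc_root (k : ℕ) : (T.desc (k + 1) T.root).card = (q + 1) * q ^ k := by
  rw [Finset.card_eq_sum_ones, sum_desc_succ]
  simp only [← Finset.card_eq_sum_ones]
  rw [Finset.sum_congr rfl fun c hc => T.card_desc (T.ne_root_of_mem_children hc) k,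
    Finset.sum_const, T.card_children_root, smul_eq_mul]

theorem pow_le_card_desc (u : V) (k : ℕ) : q ^ k ≤ (T.desc k u).card := by
  by_cases hu : u = T.root
  · subst hu
    cases k with
    | zero => simp [desc]
    | succ k => rw [card_desc_root, pow_succ']; gcongr; omega
  · rw [T.card_desc hu]

theorem card_desc_le [q.AtLeastTwo] (u : V) (k : ℕ) : (T.desc k u).card ≤ 2 * q ^ k := by
  have hq : 2 ≤ q := Nat.AtLeastTwo.prop
  by_cases hu : u = T.root
  · subst hu
    cases k with
    | zero => simp [desc]
    | succ k => rw [card_desc_root, pow_succ', ← mul_assoc]; gcongr; omega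
  · rw [T.card_desc hu]; omega

/-- The vertices that descend from `u`, including `u`. -/
def subtree (u : V) : Set V := {x | ∃ k, x ∈ T.desc k u}

theorem mem_subtree_self (u : V) : u ∈ T.subtree u := ⟨0, by simp [desc]⟩

theorem mem_subtree_iff (u x : V) :
    x ∈ T.subtree u ↔ T.level u ≤ T.level x ∧ T.parent^[T.level x - T.level u] x = u := by
  simp only [subtree, Set.mem_ofPred_eq, mem_desc]
  constructor
  · rintro ⟨k, h1, h2⟩
    refine ⟨by omega, ?_⟩
    rwa [h1, Nat.add_sub_cancel_left]
  · rintro ⟨h1, h2⟩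
    exact ⟨_, by omega, h2⟩

theorem level_le_of_mem_subtree {u x : V} (h : x ∈ T.subtree u) : T.level u ≤ T.level x :=
  ((T.mem_subtree_iff u x).1 h).1

theorem mem_subtree_root (x : V) : x ∈ T.subtree T.root := by
  rw [mem_subtree_iff, level_root, ← T.level_eq_zero, level_iterate_parent]
  omega

theorem mem_subtree_of_parent_mem {u x : V} (h : T.parent x ∈ T.subtree u) : x ∈ T.subtree u := by
  by_cases hx : x = T.root
  · rwa [hx, T.parent_root, ← hx] at h
  · obtain ⟨k, hk⟩ := h
    rw [mem_desc] at hk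
    exact ⟨k + 1, (T.mem_desc _ _ _).2 ⟨by have := T.level_parent x hx; omega, hk.2⟩⟩

theorem parent_mem_subtree {u x : V} (h : x ∈ T.subtree u) (hxu : x ≠ u) :
    T.parent x ∈ T.subtree u := by
  obtain ⟨k, hk⟩ := h
  cases k with
  | zero => simp [desc] at hk; exact absurd hk hxu
  | succ k =>
    rw [mem_desc] at hk
    refine ⟨k, (T.mem_desc _ _ _).2 ⟨?_, hk.2⟩⟩
    have hx : x ≠ T.root := by rintro rfl; rw [level_root] at hk; omega
    have := T.level_parent x hx
    omega

theorem subtree_subset_subtree_parent (u : V) : T.subtree u ⊆ T.subtree (T.parent u) := by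
  intro x hx
  by_cases hu : u = T.root
  · rw [hu, T.parent_root]; exact T.mem_subtree_root x
  · obtain ⟨k, hk⟩ := hx
    rw [mem_desc] at hk
    refine ⟨k + 1, (T.mem_desc _ _ _).2 ⟨?_, ?_⟩⟩
    · have := T.level_parent u hu; omega
    · rw [Function.iterate_succ_apply', hk.2]

/-- A branch is the disjoint union of its finite generations, since the level of a descendant
determines its generation. Summation can therefore be done generation by generation. -/
theorem hasSum_subtree {E : Type*} [AddCommMonoid E] [TopologicalSpace E] [ContinuousAdd E]
    [T3Space E] (u : V) {f : V → E} {s : E} (h : HasSum ((T.subtree u).indicator f) s) :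
    HasSum (fun k => ∑ x ∈ T.desc k u, f x) s := by
  have hinj : Function.Injective fun y : Σ k, T.desc k u => (y.2 : V) := by
    rintro ⟨k, x, hx⟩ ⟨k', x', hx'⟩ h
    obtain rfl : x = x' := h
    obtain rfl : k = k' := by
      have := T.level_of_mem_desc hx
      have := T.level_of_mem_desc hx'
      omega
    rfl
  have h1 : HasSum ((T.subtree u).indicator f ∘ fun y : Σ k, T.desc k u => (y.2 : V)) s := by
    rw [hinj.hasSum_iff]
    · exact h
    · intro x hx
      refine Set.indicator_of_notMem ?_ _
      rintro ⟨k, hk⟩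
      exact hx ⟨⟨k, x, hk⟩, rfl⟩
  refine h1.sigma fun k => ?_
  have h2 : (fun x : T.desc k u => ((T.subtree u).indicator f ∘
      fun y : Σ k, T.desc k u => (y.2 : V)) ⟨k, x⟩) = fun x : T.desc k u => f x := by
    funext x
    exact Set.indicator_of_mem (show (x : V) ∈ T.subtree u from ⟨k, x.2⟩) _
  rw [h2, ← Finset.sum_coe_sort]
  exact hasSum_fintype _

theorem hasSum_levels {E : Type*} [AddCommMonoid E] [TopologicalSpace E] [ContinuousAdd E]
    [T3Space E] {f : V → E} {s : E} (h : HasSum f s) :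
    HasSum (fun k => ∑ x ∈ T.desc k T.root, f x) s := by
  refine T.hasSum_subtree T.root ?_
  rwa [Set.indicator_eq_self.2 fun x _ => T.mem_subtree_root x]

theorem tsum_indicator_subtree (u : V) (f : V → ℝ≥0∞) :
    ∑' x, (T.subtree u).indicator f x = ∑' k, ∑ x ∈ T.desc k u, f x :=
  (T.hasSum_subtree u ENNReal.summable.hasSum).tsum_eq.symm

theorem tsum_comp_level (φ : ℕ → ℝ≥0∞) :
    ∑' x, φ (T.level x) = ∑' k, ((T.desc k T.root).card : ℝ≥0∞) * φ k := by
  rw [← (T.hasSum_levels (f := fun x => φ (T.level x)) ENNReal.summable.hasSum).tsum_eq]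
  refine tsum_congr fun k => ?_
  rw [Finset.sum_congr rfl fun x hx => by rw [T.level_of_mem_desc hx, T.level_root, zero_add],
    Finset.sum_const, nsmul_eq_mul]

theorem tsum_comp_level_le [q.AtLeastTwo] (φ : ℕ → ℝ≥0∞) :
    ∑' x, φ (T.level x) ≤ 2 * ∑' k, (q : ℝ≥0∞) ^ k * φ k := by
  rw [tsum_comp_level, ← ENNReal.tsum_mul_left]
  refine ENNReal.tsum_le_tsum fun k => ?_
  rw [← mul_assoc]
  gcongr
  exact_mod_cast T.card_desc_le T.root k

theorem le_tsum_comp_level (φ : ℕ → ℝ≥0∞) :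
    ∑' k, (q : ℝ≥0∞) ^ k * φ k ≤ ∑' x, φ (T.level x) := by
  rw [tsum_comp_level]
  refine ENNReal.tsum_le_tsum fun k => ?_
  gcongr
  exact_mod_cast T.pow_le_card_desc T.root k

/-- The ancestors of `z`, with `z` included, have pairwise different levels, so iterating the parent
map up to the level of `z` lists each once. Further iterates would only repeat the root. -/
theorem tsum_ancestors (z : V) (φ : V → ℝ≥0∞) :
    ∑' y, (T.subtree y).indicator (fun _ => φ y) z =
      ∑ i ∈ Finset.range (T.level z + 1), φ (T.parent^[i] z) := by
  classical
  have hinj : Set.InjOn (fun i => T.parent^[i] z) (Finset.range (T.level z + 1)) := by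
    intro i hi j hj h
    have h' := congrArg T.level h
    simp only [level_iterate_parent, Finset.coe_range, Set.mem_Iio] at h' hi hj
    omega
  rw [← Finset.sum_image (f := φ) hinj, tsum_eq_sum (s := (Finset.range (T.level z + 1)).image
    fun i => T.parent^[i] z)]
  · refine Finset.sum_congr rfl fun y hy => Set.indicator_of_mem ?_ _
    obtain ⟨i, hi, rfl⟩ := Finset.mem_image.1 hy
    rw [Finset.mem_range] at hi
    rw [mem_subtree_iff, level_iterate_parent]
    refine ⟨by omega, ?_⟩
    congr 2
    omega
  · intro y hy
    refine Set.indicator_of_notMem (fun h => hy ?_) _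
    rw [mem_subtree_iff] at h
    exact Finset.mem_image.2 ⟨_, Finset.mem_range.2 (by omega), h.2⟩

theorem countable {V : Type*} {q : ℕ} (T : RegularRootedTree V q) : Countable V := by
  rw [← Set.countable_univ_iff]
  refine (Set.countable_iUnion fun k => (T.desc k T.root).countable_toSet).mono fun x _ => ?_
  obtain ⟨k, hk⟩ := T.mem_subtree_root x
  exact Set.mem_iUnion.2 ⟨k, hk⟩

end RegularRootedTree

/-! ### Rooting a homogeneous tree at a vertex -/

namespace SimpleGraph

variable {V : Type*} {X : SimpleGraph V}

/-- Every such neighbour is the penultimate vertex of one fixed geodesic from `o` to `x`: otherwise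
appending the edge to that geodesic would give the path to the neighbour, which would then be
farther from `o` than `x`. -/
theorem IsTree.eq_of_adj_of_dist_eq (h : X.IsTree) {o x y y' : V} (hy : X.Adj x y)
    (hy' : X.Adj x y') (hd : X.dist o x = X.dist o y + 1) (hd' : X.dist o x = X.dist o y' + 1) :
    y = y' := by
  obtain ⟨w, hw, hwl⟩ := h.connected.exists_path_of_dist o x
  have key : ∀ z, X.Adj x z → X.dist o x = X.dist o z + 1 → z = w.penultimate := by
    intro z hz hdz
    refine h.isAcyclic.eq_penultimate_of_adj_end hw hz ?_
    by_contra hzs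
    obtain ⟨w', hw', hwl'⟩ := h.connected.exists_path_of_dist o z
    have := h.isAcyclic.path_concat hw hw' hz
      (h.isAcyclic.mem_support_of_ne_mem_support_of_adj_of_isPath hw' hw hz.symm hzs)
    rw [this, Walk.length_concat] at hwl'
    omega
  rw [key y hy hd, key y' hy' hd']

theorem IsTree.exists_adj_dist_eq (h : X.IsTree) {o x : V} (hx : x ≠ o) :
    ∃ y, X.Adj x y ∧ X.dist o x = X.dist o y + 1 := by
  obtain ⟨w, -, hwl⟩ := h.connected.exists_path_of_dist o x
  have hnil : ¬ w.Nil := fun hn => hx hn.eq.symm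
  have hadj := (w.adj_penultimate hnil).symm
  refine ⟨_, hadj, (h.dist_eq_dist_add_one_of_adj o hadj).resolve_right fun h1 => ?_⟩
  have h2 := X.dist_le w.dropLast
  rw [Walk.length_dropLast, hwl] at h2
  omega

/-- A homogeneous tree, rooted at one of its vertices. -/
noncomputable def IsTree.toRegularRootedTree [X.LocallyFinite] (h : X.IsTree) {q : ℕ}
    (hreg : X.IsRegularOfDegree (q + 1)) (o : V) : RegularRootedTree V q := by
  classical
  have hex : ∀ x, ∃ y, (x = o → y = o) ∧
      (x ≠ o → X.Adj x y ∧ X.dist o x = X.dist o y + 1) := fun x => by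
    by_cases hx : x = o
    · exact ⟨o, by simp [hx]⟩
    · obtain ⟨y, hy⟩ := h.exists_adj_dist_eq hx
      exact ⟨y, fun h => absurd h hx, fun _ => hy⟩
  choose par hpar hpar' using hex
  have hzero : ∀ x, X.dist o x = 0 ↔ x = o := fun x => by
    rw [h.connected.dist_eq_zero_iff, eq_comm]
  have hmem : ∀ x y, y ∈ (X.neighborFinset x).filter (fun y => X.dist o y = X.dist o x + 1) ↔
      y ≠ o ∧ par y = x := fun x y => by
    rw [Finset.mem_filter, mem_neighborFinset]
    constructor
    · rintro ⟨h1, h2⟩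
      have hy : y ≠ o := fun hy => by rw [(hzero y).2 hy] at h2; omega
      exact ⟨hy, h.eq_of_adj_of_dist_eq (hpar' y hy).1 h1.symm (hpar' y hy).2 h2⟩
    · rintro ⟨hy, rfl⟩
      exact ⟨(hpar' y hy).1.symm, (hpar' y hy).2⟩
  refine
    { root := o
      parent := par
      level := X.dist o
      children := fun x => (X.neighborFinset x).filter fun y => X.dist o y = X.dist o x + 1
      parent_root := hpar o rfl
      level_eq_zero := hzero
      level_parent := fun x hx => (hpar' x hx).2
      mem_children := hmem
      card_children_root := ?_
      card_children := fun x hx => ?_ }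
  · rw [Finset.filter_true_of_mem, card_neighborFinset_eq_degree, hreg o]
    intro y hy
    rw [mem_neighborFinset] at hy
    rw [X.dist_self, zero_add, dist_eq_one_iff_adj]
    exact hy
  · have h1 : (X.neighborFinset x).filter (fun y => X.dist o y = X.dist o x + 1) =
        (X.neighborFinset x).erase (par x) := by
      ext y
      rw [Finset.mem_filter, Finset.mem_erase, mem_neighborFinset]
      constructor
      · rintro ⟨h1, h2⟩
        refine ⟨?_, h1⟩
        rintro rfl
        have := (hpar' x hx).2
        omega
      · rintro ⟨h1, h2⟩
        refine ⟨h2, (h.dist_eq_dist_add_one_of_adj o h2).resolve_left fun h3 => h1 ?_⟩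
        exact h.eq_of_adj_of_dist_eq h2 (hpar' x hx).1 h3 (hpar' x hx).2
    rw [h1, Finset.card_erase_of_mem ((mem_neighborFinset _ _ _).2 (hpar' x hx).1),
      card_neighborFinset_eq_degree, hreg x, Nat.add_sub_cancel]

theorem IsTree.sum_neighborFinset [X.LocallyFinite] (h : X.IsTree) {q : ℕ}
    (hreg : X.IsRegularOfDegree (q + 1)) (o x : V) {E : Type*} [AddCommMonoid E] (f : V → E) :
    ∑ y ∈ X.neighborFinset x, f y =
      (open Classical in if x = o then 0 else f ((h.toRegularRootedTree hreg o).parent x)) +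
        ∑ y ∈ (h.toRegularRootedTree hreg o).children x, f y := by
  classical
  set T := h.toRegularRootedTree hreg o
  have hadj : ∀ y, y ≠ o → X.Adj (T.parent y) y := fun y hy => by
    have h1 : y ∈ T.children (T.parent y) := (T.mem_children _ _).2 ⟨hy, rfl⟩
    exact (mem_neighborFinset _ _ _).1 (Finset.mem_filter.1 h1).1
  by_cases hx : x = o
  · rw [if_pos hx, zero_add]
    refine (Finset.sum_subset (Finset.filter_subset _ _) fun y hy hy' => absurd ?_ hy').symm
    refine Finset.mem_filter.2 ⟨hy, ?_⟩
    rw [mem_neighborFinset, hx] at hy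
    rw [hx, X.dist_self, zero_add, dist_eq_one_iff_adj]
    exact hy
  · rw [if_neg hx]
    have h1 : T.parent x ∉ T.children x := fun h1 => by
      have h2 := T.level_child h1
      have h3 := T.level_parent x hx
      omega
    rw [← Finset.sum_insert h1]
    refine Finset.sum_congr (Finset.Subset.antisymm (fun y hy => ?_) fun y hy => ?_) fun _ _ => rfl
    · have hxy := (mem_neighborFinset _ _ _).1 hy
      refine Finset.mem_insert.2 ((h.dist_eq_dist_add_one_of_adj o hxy).imp (fun h3 => ?_)
        fun h3 => Finset.mem_filter.2 ⟨hy, h3⟩)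
      exact h.eq_of_adj_of_dist_eq hxy (hadj x hx).symm h3 (T.level_parent x hx)
    · rcases Finset.mem_insert.1 hy with rfl | hy
      · exact (mem_neighborFinset _ _ _).2 (hadj x hx).symm
      · exact (Finset.mem_filter.1 hy).1

end SimpleGraph

/-! ### Harmonic functions on the rooted tree and their pairings with sectors -/

namespace RegularRootedTree

/-- The value at distance `n` from `v` of a function that is harmonic on a branch at `v`, vanishes
at `v`, equals `1` at the neighbour of `v`, and depends only on the distance from `v`. -/
noncomputable def growth (q n : ℕ) : ℝ := ∑ i ∈ Finset.range n, ((q : ℝ)⁻¹) ^ i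

theorem growth_zero (q : ℕ) : growth q 0 = 0 := by simp [growth]

theorem growth_succ (q n : ℕ) : growth q (n + 1) = 1 + (q : ℝ)⁻¹ * growth q n := by
  rw [growth, geom_sum_succ, growth, add_comm]

theorem growth_nonneg (q n : ℕ) : 0 ≤ growth q n := Finset.sum_nonneg fun _ _ => by positivity

theorem one_le_growth_succ (q n : ℕ) : 1 ≤ growth q (n + 1) := by
  rw [growth_succ]
  have := growth_nonneg q n
  have : 0 ≤ (q : ℝ)⁻¹ * growth q n := by positivity
  linarith

section

variable {V : Type*} {q : ℕ} [q.AtLeastTwo] (T : RegularRootedTree V q)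

theorem two_le_cast (q : ℕ) [q.AtLeastTwo] : (2 : ℝ) ≤ q := by
  exact_mod_cast (Nat.AtLeastTwo.prop : 2 ≤ q)

theorem inv_cast_le (q : ℕ) [q.AtLeastTwo] : (q : ℝ)⁻¹ ≤ 1 / 2 := by
  rw [inv_eq_one_div]
  exact one_div_le_one_div_of_le (by norm_num) (two_le_cast q)

theorem growth_le (n : ℕ) : growth q n ≤ 2 := by
  induction n with
  | zero => rw [growth_zero]; norm_num
  | succ n ih =>
    rw [growth_succ]
    have := mul_le_mul (inv_cast_le q) ih (growth_nonneg q n) (by norm_num)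
    linarith

theorem growth_recurrence (n : ℕ) :
    growth q n + q * growth q (n + 2) = ((q : ℝ) + 1) * growth q (n + 1) := by
  have hq : (q : ℝ) ≠ 0 := by have := two_le_cast q; positivity
  have h (n : ℕ) : (q : ℝ) * growth q (n + 1) = q + growth q n := by
    rw [growth_succ]; field_simp
  linear_combination h (n + 1) - h n

end

section

variable {V : Type*} {q : ℕ} (T : RegularRootedTree V q)

/-- Functions whose value at each vertex is the mean of the values at its neighbours. -/
def IsHarmonic {R : Type*} [Ring R] (f : V → R) : Prop :=
  ∀ x, ((q : R) + 1) * f x =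
    (open Classical in if x = T.root then 0 else f (T.parent x)) + ∑ y ∈ T.children x, f y

/-- Conservation of flow. As the root is its own parent, its incoming increment is zero, which
compensates for its additional child and makes one formula valid everywhere. -/
theorem IsHarmonic.sum_children_sub {T : RegularRootedTree V q} {R : Type*} [CommRing R] {f : V → R}
    (hf : T.IsHarmonic f) (x : V) :
    ∑ y ∈ T.children x, (f y - f x) = f x - f (T.parent x) := by
  rw [Finset.sum_sub_distrib, Finset.sum_const, nsmul_eq_mul]
  have h := hf x
  by_cases hx : x = T.root
  · subst hx
    rw [if_pos rfl] at h
    rw [T.card_children_root, T.parent_root]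
    push_cast
    linear_combination -h
  · rw [if_neg hx] at h
    rw [T.card_children x hx]
    linear_combination -h

theorem IsHarmonic.add {T : RegularRootedTree V q} {f g : V → ℝ}
    (hf : T.IsHarmonic f) (hg : T.IsHarmonic g) : T.IsHarmonic fun x => f x + g x := fun x => by
  have h1 := hf x
  have h2 := hg x
  rw [Finset.sum_add_distrib]
  split_ifs at * <;> linear_combination h1 + h2

theorem IsHarmonic.const_mul {T : RegularRootedTree V q} {f : V → ℝ}
    (hf : T.IsHarmonic f) (r : ℝ) : T.IsHarmonic fun x => r * f x := fun x => by
  have h1 := hf x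
  rw [← Finset.mul_sum]
  split_ifs at * <;> linear_combination r * h1

theorem isHarmonic_const (r : ℝ) : T.IsHarmonic fun _ => r := fun x => by
  rw [Finset.sum_const, nsmul_eq_mul]
  split_ifs with h
  · rw [h, T.card_children_root]; push_cast; ring
  · rw [T.card_children x h]; ring

theorem IsHarmonic.ofReal {T : RegularRootedTree V q} {f : V → ℝ}
    (hf : T.IsHarmonic f) : T.IsHarmonic fun x => (f x : ℂ) := fun x => by
  have h1 := hf x
  have h2 := congrArg (fun t : ℝ => (t : ℂ)) h1
  split_ifs at * <;> push_cast at h2 <;> exact h2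

/-- The exponential weight `q ^ (-s |x|)`. -/
noncomputable def weight (s : ℝ) (x : V) : ℝ := (q : ℝ) ^ (-s * (T.level x : ℝ))

/-- The terms of the series for the moments of `growth` on a branch. -/
noncomputable def momentTerm (q : ℕ) (c : ℝ) (m k : ℕ) : ℝ :=
  growth q (k + 1) ^ m * ((q : ℝ) ^ k * (q : ℝ) ^ (-c * (k + 1 : ℝ)))

/-- The moments of `growth` on a branch. -/
noncomputable def moment (q : ℕ) (c : ℝ) (m : ℕ) : ℝ := ∑' k, momentTerm q c m k

theorem momentTerm_nonneg (c : ℝ) (m k : ℕ) : 0 ≤ momentTerm q c m k := by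
  have := growth_nonneg q (k + 1)
  unfold momentTerm
  positivity

/-- The function on the branch through `u` given by `growth`, extended by zero. -/
noncomputable def sector (u : V) : V → ℝ :=
  (T.subtree u).indicator fun x => growth q (T.level x - T.level u + 1)

theorem sector_of_mem {u x : V} (h : x ∈ T.subtree u) :
    T.sector u x = growth q (T.level x - T.level u + 1) := Set.indicator_of_mem h _

theorem sector_of_notMem {u x : V} (h : x ∉ T.subtree u) : T.sector u x = 0 :=
  Set.indicator_of_notMem h _

theorem sector_nonneg (u x : V) : 0 ≤ T.sector u x :=
  Set.indicator_nonneg (fun _ _ => growth_nonneg _ _) _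

/-- The deviation of a sector function from the mean of its siblings: a harmonic function which is
supported on the descendants of the parent of `u`. -/
noncomputable def sectorDev (u x : V) : ℝ :=
  T.sector u x - ((T.children (T.parent u)).card : ℝ)⁻¹ *
    ∑ y ∈ T.children (T.parent u), T.sector y x

theorem sectorDev_root {u : V} (hu : u ≠ T.root) : T.sectorDev u T.root = 0 := by
  have h : ∀ y, y ≠ T.root → T.sector y T.root = 0 := fun y hy => T.sector_of_notMem fun hr => by
    have := T.level_le_of_mem_subtree hr
    rw [T.level_root, Nat.le_zero, T.level_eq_zero] at this
    exact hy this
  rw [sectorDev, h u hu, Finset.sum_eq_zero fun y hy => h y (T.ne_root_of_mem_children hy)]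
  simp

theorem summable_mul_of_bounded {c : ℝ} {g : V → ℂ} (hg : Summable fun x => g x * (T.weight c x : ℂ))
    {k : V → ℝ} {R : ℝ} (hk : ∀ x, |k x| ≤ R) :
    Summable fun x => g x * ((k x * T.weight c x : ℝ) : ℂ) := by
  refine Summable.of_norm_bounded (hg.norm.mul_left R) fun x => ?_
  have : g x * ((k x * T.weight c x : ℝ) : ℂ) = (k x : ℂ) * (g x * (T.weight c x : ℂ)) := by
    push_cast; ring
  rw [this, norm_mul, Complex.norm_real, Real.norm_eq_abs]
  gcongr
  exact hk x

end

variable {V : Type*} {q : ℕ} [q.AtLeastTwo] (T : RegularRootedTree V q)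

theorem cast_pos (q : ℕ) [q.AtLeastTwo] : (0 : ℝ) < q := by have := two_le_cast q; linarith

theorem weight_pos (s : ℝ) (x : V) : 0 < T.weight s x := Real.rpow_pos_of_pos (cast_pos q) _

/-- Summing the inductive formula over the children `c` of `u` leaves only the increments `g c - g
u`, whose sum is the incoming increment at `u`. The coefficients then follow the recursion
`growth_succ`. -/
theorem IsHarmonic.sum_desc {T : RegularRootedTree V q} {g : V → ℂ} (hg : T.IsHarmonic g) {u : V}
    (hu : u ≠ T.root) (k : ℕ) :
    ∑ x ∈ T.desc k u, g x = (q : ℂ) ^ k *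
      (g (T.parent u) + (growth q (k + 1) : ℂ) * (g u - g (T.parent u))) := by
  induction k generalizing u with
  | zero =>
    simp only [desc, growth_succ, growth_zero]
    simp
  | succ k ih =>
    have hq : (q : ℂ) ≠ 0 := by exact_mod_cast (cast_pos q).ne'
    rw [sum_desc_succ, Finset.sum_congr rfl fun c hc => by
      rw [ih (T.ne_root_of_mem_children hc), T.parent_of_mem_children hc]]
    rw [← Finset.mul_sum, Finset.sum_add_distrib, ← Finset.mul_sum, hg.sum_children_sub,
      Finset.sum_const, nsmul_eq_mul, T.card_children u hu, growth_succ q (k + 1)]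
    push_cast
    field_simp
    ring

theorem IsHarmonic.sum_desc_root {T : RegularRootedTree V q} {g : V → ℂ} (hg : T.IsHarmonic g)
    (k : ℕ) : ∑ x ∈ T.desc k T.root, g x = (T.desc k T.root).card * g T.root := by
  cases k with
  | zero => simp [desc]
  | succ k =>
    rw [sum_desc_succ, Finset.sum_congr rfl fun c hc => by
      rw [hg.sum_desc (T.ne_root_of_mem_children hc), T.parent_of_mem_children hc]]
    rw [← Finset.mul_sum, Finset.sum_add_distrib, ← Finset.mul_sum, hg.sum_children_sub,
      T.parent_root, Finset.sum_const, nsmul_eq_mul, T.card_children_root, T.card_desc_root]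
    push_cast
    ring

theorem pow_mul_rpow (s : ℝ) (k : ℕ) :
    (q : ℝ) ^ k * (q : ℝ) ^ (s * k) = ((q : ℝ) ^ (1 + s)) ^ k := by
  have hq := cast_pos q
  rw [← Real.rpow_natCast, ← Real.rpow_natCast ((q : ℝ) ^ (1 + s)), ← Real.rpow_mul hq.le,
    ← Real.rpow_add hq]
  congr 1; ring

theorem rpow_lt_one_iff (s : ℝ) : (q : ℝ) ^ s < 1 ↔ s < 0 := by
  have h : (1 : ℝ) < q := by have := two_le_cast q; linarith
  rw [← Real.rpow_zero (q : ℝ), Real.rpow_lt_rpow_left_iff h]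

theorem summable_pow_mul_rpow_iff (s : ℝ) :
    Summable (fun k : ℕ => (q : ℝ) ^ k * (q : ℝ) ^ (s * k)) ↔ s < -1 := by
  simp only [pow_mul_rpow]
  rw [summable_geometric_iff_norm_lt_one, Real.norm_of_nonneg (by positivity), rpow_lt_one_iff]
  constructor <;> intro h <;> linarith

theorem tsum_ofReal_ne_top_iff {ι : Type*} {f : ι → ℝ} (hf : ∀ i, 0 ≤ f i) :
    ∑' i, ENNReal.ofReal (f i) ≠ ⊤ ↔ Summable f :=
  ⟨fun h => (ENNReal.summable_toReal h).congr fun i => ENNReal.toReal_ofReal (hf i),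
    fun h => h.tsum_ofReal_ne_top⟩

/-- Generation `k` of the root has between `q^k` and `2 q^k` vertices. -/
theorem summable_comp_level_iff {φ : ℕ → ℝ} (hφ : ∀ n, 0 ≤ φ n) :
    Summable (fun x => φ (T.level x)) ↔ Summable fun k : ℕ => (q : ℝ) ^ k * φ k := by
  have h (k : ℕ) : (q : ℝ≥0∞) ^ k * ENNReal.ofReal (φ k) = ENNReal.ofReal ((q : ℝ) ^ k * φ k) := by
    rw [ENNReal.ofReal_mul (by positivity), ENNReal.ofReal_pow (by positivity),
      ENNReal.ofReal_natCast]
  rw [← tsum_ofReal_ne_top_iff fun x => hφ _,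
    ← tsum_ofReal_ne_top_iff fun k => mul_nonneg (by positivity) (hφ k)]
  simp only [← h]
  refine ⟨fun h' => ne_top_of_le_ne_top h' (T.le_tsum_comp_level fun n => ENNReal.ofReal (φ n)),
    fun h' => ?_⟩
  exact ne_top_of_le_ne_top (ENNReal.mul_ne_top (by simp) h')
    (T.tsum_comp_level_le fun n => ENNReal.ofReal (φ n))

theorem summable_weight {c : ℝ} (hc : 1 < c) : Summable (T.weight c) := by
  refine (T.summable_comp_level_iff (φ := fun n => (q : ℝ) ^ (-c * n)) fun n => by positivity).2 ?_
  exact (summable_pow_mul_rpow_iff _).2 (by linarith)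

theorem hasSum_momentTerm (m : ℕ) {c : ℝ} (hc : 1 < c) :
    HasSum (momentTerm q c m) (moment q c m) := by
  have hq := cast_pos q
  have h1 : ∀ k : ℕ, (q : ℝ) ^ k * (q : ℝ) ^ (-c * (k + 1 : ℝ)) =
      (q : ℝ) ^ (-c) * ((q : ℝ) ^ k * (q : ℝ) ^ (-c * k)) := fun k => by
    rw [mul_left_comm, ← Real.rpow_add hq]
    congr 2; ring
  refine (Summable.of_nonneg_of_le (fun k => momentTerm_nonneg c m k) (fun k => ?_)
    ((((summable_pow_mul_rpow_iff (q := q) (-c)).2 (by linarith)).mul_left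
      ((q : ℝ) ^ (-c))).mul_left (2 ^ m))).hasSum
  rw [momentTerm, h1]
  have := growth_nonneg q (k + 1)
  gcongr
  exact growth_le _

theorem moment_pos (m : ℕ) {c : ℝ} (hc : 1 < c) : 0 < moment q c m := by
  have hq := cast_pos q
  refine (hasSum_momentTerm m hc).summable.tsum_pos (fun k => momentTerm_nonneg c m k) 0 ?_
  have := one_le_growth_succ q 0
  unfold momentTerm
  positivity

theorem sector_le (u x : V) : T.sector u x ≤ 2 :=
  Set.indicator_le' (fun _ _ => growth_le _) (fun _ _ => by simp) _

/-- A sector function is harmonic except for a unit defect at the parent of `u`. Siblings share this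
defect, so it disappears from the difference between a sector and the mean over its siblings. -/
theorem sector_parent_add_sum {u : V} (hu : u ≠ T.root) (x : V) :
    (open Classical in if x = T.root then 0 else T.sector u (T.parent x)) +
      ∑ y ∈ T.children x, T.sector u y =
    ((q : ℝ) + 1) * T.sector u x + (open Classical in if x = T.parent u then 1 else 0) := by
  classical
  have hlu := T.level_parent u hu
  have hpu : T.parent u ∉ T.subtree u := fun h => by
    have := T.level_le_of_mem_subtree h
    omega
  by_cases hx : x ∈ T.subtree u
  · have hlx := T.level_le_of_mem_subtree hx
    have hxr : x ≠ T.root := by rintro rfl; rw [T.level_root] at hlx; omega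
    have hlp := T.level_parent x hxr
    have h1 : T.sector u (T.parent x) = growth q (T.level x - T.level u) := by
      by_cases hxu : x = u
      · rw [hxu, T.sector_of_notMem hpu, Nat.sub_self, growth_zero]
      · have h2 := T.parent_mem_subtree hx hxu
        have := T.level_le_of_mem_subtree h2
        rw [T.sector_of_mem h2]
        congr 1
        omega
    have h2 : ∀ y ∈ T.children x, T.sector u y = growth q (T.level x - T.level u + 2) :=
      fun y hy => by
        rw [T.sector_of_mem (T.mem_subtree_of_parent_mem (by rwa [T.parent_of_mem_children hy])),
          T.level_child hy]
        congr 1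
        omega
    rw [if_neg hxr, if_neg (by rintro rfl; exact hpu hx), h1, Finset.sum_congr rfl h2,
      Finset.sum_const, T.card_children x hxr, nsmul_eq_mul, growth_recurrence, T.sector_of_mem hx,
      add_zero]
  · have h1 : (if x = T.root then 0 else T.sector u (T.parent x)) = 0 := by
      split_ifs
      · rfl
      · exact T.sector_of_notMem fun h => hx (T.mem_subtree_of_parent_mem h)
    have h2 : ∀ y ∈ T.children x, y ≠ u → T.sector u y = 0 := fun y hy hyu =>
      T.sector_of_notMem fun h => hx (by
        rw [← T.parent_of_mem_children hy]; exact T.parent_mem_subtree h hyu)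
    rw [h1, T.sector_of_notMem hx, mul_zero]
    by_cases hxu : x = T.parent u
    · rw [if_pos hxu, Finset.sum_eq_single u h2 fun h =>
        absurd ((T.mem_children _ _).2 ⟨hu, hxu.symm⟩) h,
        T.sector_of_mem (T.mem_subtree_self u), Nat.sub_self, growth_succ, growth_zero]
      simp
    · rw [if_neg hxu, Finset.sum_eq_zero fun y hy => h2 y hy ?_]
      rintro rfl
      exact hxu (T.parent_of_mem_children hy).symm

theorem weight_add_level (c : ℝ) {v x : V} {k : ℕ} (h : T.level x = T.level v + 1 + k) :
    T.weight c x = T.weight c v * (q : ℝ) ^ (-c * (k + 1 : ℝ)) := by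
  rw [weight, weight, h, ← Real.rpow_add (cast_pos q)]
  push_cast
  congr 1; ring

/-- On each generation both the sector function and the weight are constant, so
`IsHarmonic.sum_desc` evaluates the partial sums. Bounded sectors give absolute convergence, and
uniqueness of the limit then identifies the sum over the vertices. -/
theorem IsHarmonic.hasSum_sector {T : RegularRootedTree V q} {c : ℝ} (hc : 1 < c) {g : V → ℂ}
    (hg : T.IsHarmonic g) (hs : Summable fun x => g x * (T.weight c x : ℂ)) {u : V}
    (hu : u ≠ T.root) :
    HasSum (fun x => g x * ((T.sector u x * T.weight c x : ℝ) : ℂ))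
      ((T.weight c (T.parent u) : ℂ) * ((moment q c 1 : ℂ) * g (T.parent u) +
        (moment q c 2 : ℂ) * (g u - g (T.parent u)))) := by
  have hb : ∀ x, |T.sector u x| ≤ 2 := fun x => by
    rw [abs_of_nonneg (T.sector_nonneg u x)]; exact T.sector_le u x
  obtain ⟨s, hsum⟩ := T.summable_mul_of_bounded hs hb
  have h1 : (fun x => g x * ((T.sector u x * T.weight c x : ℝ) : ℂ)) = (T.subtree u).indicator
      fun x => g x * ((growth q (T.level x - T.level u + 1) * T.weight c x : ℝ) : ℂ) := by
    funext x
    by_cases hx : x ∈ T.subtree u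
    · rw [Set.indicator_of_mem hx, T.sector_of_mem hx]
    · rw [Set.indicator_of_notMem hx, T.sector_of_notMem hx]; simp
  rw [h1] at hsum
  have h2 := T.hasSum_subtree u hsum
  have h3 : ∀ k, ∑ x ∈ T.desc k u,
      g x * ((growth q (T.level x - T.level u + 1) * T.weight c x : ℝ) : ℂ) =
      (T.weight c (T.parent u) : ℂ) * ((momentTerm q c 1 k : ℂ) * g (T.parent u) +
        (momentTerm q c 2 k : ℂ) * (g u - g (T.parent u))) := fun k => by
    have h4 : ∀ x ∈ T.desc k u,
        g x * ((growth q (T.level x - T.level u + 1) * T.weight c x : ℝ) : ℂ) = g x *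
          ((growth q (k + 1) * (T.weight c (T.parent u) * (q : ℝ) ^ (-c * (k + 1 : ℝ))) : ℝ) : ℂ) :=
      fun x hx => by
        have hl := T.level_of_mem_desc hx
        rw [T.weight_add_level c (v := T.parent u) (k := k) (by rw [hl, T.level_parent u hu]), hl,
          Nat.add_sub_cancel_left]
    rw [Finset.sum_congr rfl h4, ← Finset.sum_mul, hg.sum_desc hu, momentTerm, momentTerm]
    push_cast
    ring
  simp only [h3] at h2
  have h5 := (((Complex.hasSum_ofReal.2 (hasSum_momentTerm (q := q) 1 hc)).mul_right
    (g (T.parent u))).add ((Complex.hasSum_ofReal.2 (hasSum_momentTerm (q := q) 2 hc)).mul_right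
    (g u - g (T.parent u)))).mul_left (T.weight c (T.parent u) : ℂ)
  rw [h1, ← h2.unique h5]
  exact hsum

theorem two_le_card_children (x : V) : (2 : ℝ) ≤ (T.children x).card := by
  have h : (q : ℝ) ≤ (T.children x).card := by
    by_cases hx : x = T.root
    · rw [hx, T.card_children_root]; push_cast; linarith
    · rw [T.card_children x hx]
  exact (two_le_cast q).trans h

theorem isHarmonic_sectorDev {u : V} (hu : u ≠ T.root) : T.IsHarmonic (T.sectorDev u) := fun x => by
  classical
  have hcard := T.two_le_card_children (T.parent u)
  have h1 := T.sector_parent_add_sum hu x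
  have h2 := Finset.sum_congr (rfl : T.children (T.parent u) = _) fun y hy =>
    T.sector_parent_add_sum (T.ne_root_of_mem_children hy) x
  rw [Finset.sum_add_distrib, Finset.sum_add_distrib, ← Finset.mul_sum] at h2
  have h3 : ∑ y ∈ T.children (T.parent u), (if x = T.parent y then (1 : ℝ) else 0) =
      (T.children (T.parent u)).card * if x = T.parent u then 1 else 0 := by
    rw [Finset.sum_congr rfl fun y hy => by rw [T.parent_of_mem_children hy], Finset.sum_const,
      nsmul_eq_mul]
  rw [h3, Finset.sum_comm] at h2
  have h4 : ((T.children (T.parent u)).card : ℝ)⁻¹ * (T.children (T.parent u)).card = 1 :=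
    inv_mul_cancel₀ (by linarith)
  simp only [sectorDev, Finset.sum_sub_distrib, ← Finset.mul_sum]
  by_cases hx : x = T.root
  · simp only [if_pos hx, Finset.sum_const_zero] at *
    linear_combination (-1 : ℝ) * h1 + ((T.children (T.parent u)).card : ℝ)⁻¹ * h2 +
      (if x = T.parent u then 1 else 0) * h4
  · simp only [if_neg hx] at *
    linear_combination (-1 : ℝ) * h1 + ((T.children (T.parent u)).card : ℝ)⁻¹ * h2 +
      (if x = T.parent u then 1 else 0) * h4

/-- Both the sector and the mean of the sibling sectors take values in `[0, 2]` and vanish off the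
branch at the parent of `u`. -/
theorem abs_sectorDev_le (u x : V) :
    |T.sectorDev u x| ≤ 2 * (T.subtree (T.parent u)).indicator 1 x := by
  have hcard := T.two_le_card_children (T.parent u)
  by_cases hx : x ∈ T.subtree (T.parent u)
  · rw [Set.indicator_of_mem hx, Pi.one_apply, mul_one, sectorDev]
    have h1 : ∑ y ∈ T.children (T.parent u), T.sector y x ≤ (T.children (T.parent u)).card * 2 := by
      rw [← nsmul_eq_mul]
      exact Finset.sum_le_card_nsmul _ _ _ fun y _ => T.sector_le y x
    have h2 : 0 ≤ ∑ y ∈ T.children (T.parent u), T.sector y x :=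
      Finset.sum_nonneg fun y _ => T.sector_nonneg y x
    refine abs_sub_le_of_nonneg_of_le (T.sector_nonneg u x) (T.sector_le u x) (by positivity) ?_
    rw [inv_mul_le_iff₀ (by linarith)]
    exact h1
  · rw [Set.indicator_of_notMem hx, sectorDev,
      T.sector_of_notMem fun h => hx (T.subtree_subset_subtree_parent u h), Finset.sum_eq_zero]
    · simp
    · intro y hy
      refine T.sector_of_notMem fun h => hx ?_
      rw [← T.parent_of_mem_children hy]
      exact T.subtree_subset_subtree_parent y h

/-- On the branch at `u` the other siblings vanish, so the deviation is `1 - 1/n` times a sector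
value that is at least `1`, where `n ≥ 2` is the number of siblings. -/
theorem half_le_sectorDev {u x : V} (hu : u ≠ T.root) (hx : x ∈ T.subtree u) :
    1 / 2 ≤ T.sectorDev u x := by
  have hcard := T.two_le_card_children (T.parent u)
  have h1 : ∑ y ∈ T.children (T.parent u), T.sector y x = T.sector u x := by
    refine Finset.sum_eq_single u (fun y hy hyu => T.sector_of_notMem fun h => hyu ?_) fun h =>
      absurd ((T.mem_children _ _).2 ⟨hu, rfl⟩) h
    rw [mem_subtree_iff] at h hx
    rw [← h.2, ← hx.2, T.level_child hy, T.level_parent u hu]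
  have h2 : 1 ≤ T.sector u x := by rw [T.sector_of_mem hx]; exact one_le_growth_succ _ _
  rw [sectorDev, h1]
  have h3 : ((T.children (T.parent u)).card : ℝ)⁻¹ ≤ 2⁻¹ := inv_anti₀ (by norm_num) hcard
  nlinarith

/-- Subtracting the mean over siblings cancels the terms with the first moment; what remains
involves increments of `g` alone. -/
theorem IsHarmonic.hasSum_sectorDev {T : RegularRootedTree V q} {c : ℝ} (hc : 1 < c) {g : V → ℂ}
    (hg : T.IsHarmonic g) (hs : Summable fun x => g x * (T.weight c x : ℂ)) {u : V}
    (hu : u ≠ T.root) :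
    HasSum (fun x => g x * ((T.sectorDev u x * T.weight c x : ℝ) : ℂ))
      ((T.weight c (T.parent u) * moment q c 2 : ℝ) * ((g u - g (T.parent u)) -
        ((T.children (T.parent u)).card : ℂ)⁻¹ *
          (g (T.parent u) - g (T.parent (T.parent u))))) := by
  have hcard := T.two_le_card_children (T.parent u)
  have hcard' : ((T.children (T.parent u)).card : ℂ) ≠ 0 := by
    have : (T.children (T.parent u)).card ≠ 0 := fun h => by rw [h] at hcard; norm_num at hcard
    exact_mod_cast this
  have h1 := (hg.hasSum_sector hc hs hu).sub ((hasSum_sum fun y hy =>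
    hg.hasSum_sector hc hs (T.ne_root_of_mem_children (x := T.parent u) hy)).mul_left
      ((T.children (T.parent u)).card : ℂ)⁻¹)
  have h2 : ∑ y ∈ T.children (T.parent u), (T.weight c (T.parent y) : ℂ) *
      ((moment q c 1 : ℂ) * g (T.parent y) + (moment q c 2 : ℂ) * (g y - g (T.parent y))) =
      (T.weight c (T.parent u) : ℂ) * ((T.children (T.parent u)).card *
        ((moment q c 1 : ℂ) * g (T.parent u)) + (moment q c 2 : ℂ) *
          (g (T.parent u) - g (T.parent (T.parent u)))) := by
    rw [← hg.sum_children_sub, ← nsmul_eq_mul, ← Finset.sum_const, Finset.mul_sum,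
      ← Finset.sum_add_distrib, Finset.mul_sum]
    exact Finset.sum_congr rfl fun y hy => by rw [T.parent_of_mem_children hy]
  have h3 : ((T.weight c (T.parent u) * moment q c 2 : ℝ) : ℂ) * ((g u - g (T.parent u)) -
      ((T.children (T.parent u)).card : ℂ)⁻¹ *
        (g (T.parent u) - g (T.parent (T.parent u)))) =
      (T.weight c (T.parent u) : ℂ) * ((moment q c 1 : ℂ) * g (T.parent u) +
        (moment q c 2 : ℂ) * (g u - g (T.parent u))) - ((T.children (T.parent u)).card : ℂ)⁻¹ *
      ∑ y ∈ T.children (T.parent u), (T.weight c (T.parent y) : ℂ) *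
        ((moment q c 1 : ℂ) * g (T.parent y) + (moment q c 2 : ℂ) * (g y - g (T.parent y))) := by
    rw [h2]
    push_cast
    field_simp
    ring
  rw [h3]
  refine (congrArg (fun f => HasSum f _) (funext fun x => ?_)).mpr h1
  rw [sectorDev, ← Finset.mul_sum]
  push_cast
  rw [← Finset.sum_mul]
  ring

end RegularRootedTree

/-! ### Recursive construction and estimates of the reproducing kernel -/

namespace RegularRootedTree

section

variable {V : Type*} {q : ℕ} (T : RegularRootedTree V q)

/-- A majorant of the kernel, up to a constant. -/
noncomputable def majorant (c : ℝ) (z x : V) : ℝ :=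
  1 + ∑ i ∈ Finset.range (T.level z), T.weight (-c) (T.parent^[i + 1] z) *
    (T.subtree (T.parent^[i + 1] z)).indicator 1 x

theorem majorant_of_ne_root (c : ℝ) {z : V} (hz : z ≠ T.root) (x : V) :
    T.majorant c z x = T.majorant c (T.parent z) x +
      T.weight (-c) (T.parent z) * (T.subtree (T.parent z)).indicator 1 x := by
  rw [majorant, T.level_parent z hz, Finset.sum_range_succ', majorant, ← add_assoc]
  rfl

end

variable {V : Type*} {q : ℕ} [q.AtLeastTwo] (T : RegularRootedTree V q)

theorem weight_mul_weight_neg (s : ℝ) (x : V) : T.weight s x * T.weight (-s) x = 1 := by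
  rw [weight, weight, ← Real.rpow_add (cast_pos q)]
  ring_nf
  exact Real.rpow_zero _

theorem weight_neg_of_ne_root (s : ℝ) {z : V} (hz : z ≠ T.root) :
    T.weight (-s) z = (q : ℝ) ^ s * T.weight (-s) (T.parent z) := by
  rw [weight, weight, ← Real.rpow_add (cast_pos q), T.level_parent z hz]
  push_cast
  congr 1; ring

/-- The total mass of the exponential weight. -/
noncomputable def mass (c : ℝ) : ℝ := ∑' x, T.weight c x

theorem mass_pos {c : ℝ} (hc : 1 < c) : 0 < T.mass c :=
  (T.summable_weight hc).tsum_pos (fun x => (T.weight_pos c x).le) T.root (T.weight_pos c _)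

theorem IsHarmonic.hasSum_weight {T : RegularRootedTree V q} {c : ℝ} (hc : 1 < c) {g : V → ℂ}
    (hg : T.IsHarmonic g) (hs : Summable fun x => g x * (T.weight c x : ℂ)) :
    HasSum (fun x => g x * (T.weight c x : ℂ)) (T.mass c * g T.root) := by
  have hw : ∀ k, ∀ x ∈ T.desc k T.root, T.weight c x = (q : ℝ) ^ (-c * (k : ℝ)) := fun k x hx => by
    rw [weight, T.level_of_mem_desc hx, T.level_root, zero_add]
  obtain ⟨s, hsum⟩ := hs
  have h1 := T.hasSum_levels hsum
  have h2 := (Complex.hasSum_ofReal.2 (T.hasSum_levels (T.summable_weight hc).hasSum)).mul_right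
    (g T.root)
  have h3 : ∀ k, ∑ x ∈ T.desc k T.root, g x * (T.weight c x : ℂ) =
      ((∑ x ∈ T.desc k T.root, T.weight c x : ℝ) : ℂ) * g T.root := fun k => by
    rw [Finset.sum_congr rfl (hw k), Finset.sum_congr rfl fun x hx => by rw [hw k x hx],
      ← Finset.sum_mul, hg.sum_desc_root, Finset.sum_const, nsmul_eq_mul]
    push_cast
    ring
  simp only [h3] at h1
  have h4 := h1.unique h2
  rw [h4] at hsum
  exact hsum

theorem majorant_le (c : ℝ) (z x : V) : T.majorant c z x ≤
    1 + ∑ i ∈ Finset.range (T.level z), T.weight (-c) (T.parent^[i + 1] z) := by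
  refine add_le_add_right (Finset.sum_le_sum fun i _ => ?_) _
  refine mul_le_of_le_one_right (T.weight_pos _ _).le ?_
  exact Set.indicator_le' (fun _ _ => le_rfl) (fun _ _ => zero_le_one) _

/-- The summand of the root equals `1` and absorbs the constant term of the majorant, at the price
of the factor `2`. The added summand `i = 0`, for `z` itself, is nonnegative. -/
theorem majorant_le_two_mul (c : ℝ) (z x : V) : T.majorant c z x ≤
    2 * ∑ i ∈ Finset.range (T.level z + 1), T.weight (-c) (T.parent^[i] z) *
      (T.subtree (T.parent^[i] z)).indicator 1 x := by
  have h0 : ∀ i ∈ Finset.range (T.level z + 1), 0 ≤ T.weight (-c) (T.parent^[i] z) *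
      (T.subtree (T.parent^[i] z)).indicator 1 x := fun i _ =>
    mul_nonneg (T.weight_pos _ _).le (Set.indicator_nonneg (fun _ _ => zero_le_one) _)
  have hroot : T.parent^[T.level z] z = T.root := by
    rw [← T.level_eq_zero, level_iterate_parent, Nat.sub_self]
  have h1 := Finset.single_le_sum h0 (Finset.self_mem_range_succ (T.level z))
  rw [hroot, Set.indicator_of_mem (T.mem_subtree_root x), weight, T.level_root] at h1
  norm_num at h1
  have h2 := h0 0 (by simp)
  rw [Finset.sum_range_succ'] at h1 ⊢
  rw [majorant]
  linarith

/-- The functions `k` and `d` represent the evaluation at `z` and its increment from the parent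
of `z`, with the estimates that an induction along the ancestors of `z` provides. -/
structure IsKernelPair (c C κ : ℝ) (z : V) (k d : V → ℝ) : Prop where
  harmonic : T.IsHarmonic k
  harmonic_incr : T.IsHarmonic d
  hasSum : ∀ g : V → ℂ, T.IsHarmonic g → Summable (fun x => g x * (T.weight c x : ℂ)) →
    HasSum (fun x => g x * ((k x * T.weight c x : ℝ) : ℂ)) (g z)
  hasSum_incr : ∀ g : V → ℂ, T.IsHarmonic g → Summable (fun x => g x * (T.weight c x : ℂ)) →
    HasSum (fun x => g x * ((d x * T.weight c x : ℝ) : ℂ)) (g z - g (T.parent z))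
  le_incr : ∀ x, |d x| ≤ C * T.majorant c z x
  le_comb : ∀ x, |k x + d x / ((q : ℝ) - 1)| ≤ C * T.majorant c z x
  incr_nonneg : ∀ x ∈ T.subtree z, 0 ≤ d x
  lower : ∀ x ∈ T.subtree z, κ * T.weight (-c) z ≤ k x
  apply_root : k T.root = (T.mass c)⁻¹
  incr_apply_root : d T.root = 0
  eq_of_root : z = T.root → (∀ x, d x = 0) ∧ ∀ x, k x = (T.mass c)⁻¹

/-- Adding the bounds on the increments along the path would count each ancestor many times. The
combination `k + d / (q - 1)` avoids this: in passing to a child it changes only by a multiple of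
the new `sectorDev`, so each ancestor contributes once. -/
theorem exists_isKernelPair {c : ℝ} (hc : 1 < c) : ∃ C κ : ℝ, 0 < C ∧ 0 < κ ∧
    ∀ z, ∃ k d : V → ℝ, T.IsKernelPair c C κ z k d := by
  have hM := T.mass_pos hc
  have hN := moment_pos (q := q) 2 hc
  have hq := two_le_cast q
  have hqc : 0 < (q : ℝ) ^ c := Real.rpow_pos_of_pos (cast_pos q) _
  set M := T.mass c
  set N := moment q c 2 with hNdef
  -- This half of `κ` makes `κ q^(c|z|)` at most the new contribution `N⁻¹/2 * q^(c|v|)` at the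
  -- parent `v` of `z`; the other half serves the root.
  have hκ2 : min M⁻¹ (N⁻¹ / 2 / (q : ℝ) ^ c) * (q : ℝ) ^ c ≤ N⁻¹ / 2 := by
    rw [← le_div_iff₀ hqc]; exact min_le_right _ _
  have hκ1 : min M⁻¹ (N⁻¹ / 2 / (q : ℝ) ^ c) ≤ M⁻¹ := min_le_left _ _
  have hκ0 : 0 < min M⁻¹ (N⁻¹ / 2 / (q : ℝ) ^ c) := lt_min (by positivity) (by positivity)
  set κ := min M⁻¹ (N⁻¹ / 2 / (q : ℝ) ^ c)
  -- `M⁻¹` is the kernel at the root; in `4 * N⁻¹` one factor `2` bounds `sectorDev` and the other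
  -- bounds `q / (q - 1)`.
  have hC1 : M⁻¹ ≤ M⁻¹ + 4 * N⁻¹ := by
    have : 0 < N⁻¹ := by positivity
    linarith
  have hC2 : 4 * N⁻¹ ≤ M⁻¹ + 4 * N⁻¹ := by
    have : 0 < M⁻¹ := by positivity
    linarith
  have hC0 : 0 < M⁻¹ + 4 * N⁻¹ := by positivity
  set C := M⁻¹ + 4 * N⁻¹
  refine ⟨C, κ, hC0, hκ0, T.induction ?_ ?_⟩
  · have hmaj : ∀ x, T.majorant c T.root x = 1 := fun x => by
      rw [majorant, T.level_root]; simp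
    refine ⟨fun _ => M⁻¹, fun _ => 0, T.isHarmonic_const _, T.isHarmonic_const _, ?_, ?_, ?_, ?_,
      fun _ _ => le_rfl, ?_, rfl, rfl, fun _ => ⟨fun _ => rfl, fun _ => rfl⟩⟩
    · intro g hg hs
      have h := (hg.hasSum_weight hc hs).mul_left ((M : ℂ)⁻¹)
      rw [← mul_assoc, inv_mul_cancel₀ (by exact_mod_cast hM.ne'), one_mul] at h
      refine (congrArg (fun f => HasSum f _) (funext fun x => ?_)).mpr h
      push_cast
      ring
    · intro g hg hs
      rw [T.parent_root, sub_self]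
      simp
    · intro x
      rw [hmaj, abs_zero]
      linarith
    · intro x
      rw [hmaj, zero_div, add_zero, mul_one, abs_of_pos (by positivity)]
      exact hC1
    · intro x _
      rw [weight, T.level_root]
      simpa using hκ1
  · rintro z hz ⟨k, d, h⟩
    set v := T.parent z with hv
    have hcard := T.two_le_card_children v
    obtain ⟨n, hn⟩ : ∃ n : ℝ, n = (T.children v).card := ⟨_, rfl⟩
    rw [← hn] at hcard
    have hwv := T.weight_pos (-c) v
    set F := T.sectorDev z with hF
    -- By `IsHarmonic.hasSum_sectorDev` the second term represents the increment at `z` minus `n⁻¹`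
    -- times the increment at `v`; the first term restores what is missing.
    set e : V → ℝ := fun x => n⁻¹ * d x + N⁻¹ * T.weight (-c) v * F x with he
    have hF2 : ∀ x, |N⁻¹ * T.weight (-c) v * F x| ≤
        2 * N⁻¹ * (T.weight (-c) v * (T.subtree v).indicator 1 x) := fun x => by
      rw [abs_mul, abs_of_pos (by positivity)]
      calc N⁻¹ * T.weight (-c) v * |F x| ≤
          N⁻¹ * T.weight (-c) v * (2 * (T.subtree v).indicator 1 x) := by
            gcongr; exact T.abs_sectorDev_le z x
        _ = _ := by ring
    have hI : ∀ x, 0 ≤ T.weight (-c) v * (T.subtree v).indicator 1 x := fun x =>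
      mul_nonneg hwv.le (Set.indicator_nonneg (fun _ _ => zero_le_one) _)
    have he0 : ∀ x ∈ T.subtree z, N⁻¹ / 2 * T.weight (-c) v ≤ e x := fun x hx => by
      have h1 := h.incr_nonneg x (T.subtree_subset_subtree_parent z hx)
      have h2 := T.half_le_sectorDev hz hx
      have h3 : N⁻¹ * T.weight (-c) v * (1 / 2) ≤ N⁻¹ * T.weight (-c) v * F x := by gcongr
      have h4 : 0 ≤ n⁻¹ * d x := mul_nonneg (by positivity) h1
      simp only [he]
      linarith
    have hcast : ((T.children v).card : ℂ) = ((n : ℝ) : ℂ) := by rw [hn]; push_cast; rfl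
    have hsum_e : ∀ g : V → ℂ, T.IsHarmonic g → Summable (fun x => g x * (T.weight c x : ℂ)) →
        HasSum (fun x => g x * ((e x * T.weight c x : ℝ) : ℂ)) (g z - g v) := by
      intro g hg hs
      have h1 := ((h.hasSum_incr g hg hs).mul_left ((n⁻¹ : ℝ) : ℂ)).add
        ((hg.hasSum_sectorDev hc hs hz).mul_left ((N⁻¹ * T.weight (-c) v : ℝ) : ℂ))
      have h2 : ((N⁻¹ * T.weight (-c) v : ℝ) : ℂ) * ((T.weight c v * N : ℝ) : ℂ) = 1 := by
        rw [← Complex.ofReal_mul, ← Complex.ofReal_one]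
        congr 1
        have := T.weight_mul_weight_neg c v
        field_simp
        linarith
      rw [← hv, ← hNdef, hcast, ← mul_assoc, h2, one_mul] at h1
      refine (congrArg₂ (fun f s => HasSum f s) (funext fun x => ?_) ?_).mpr h1
      · simp only [he]
        push_cast
        ring
      · push_cast
        ring
    refine ⟨fun x => k x + e x, e, ?_, ?_, ?_, hsum_e, ?_, ?_, ?_, ?_, ?_, ?_,
      fun h => absurd h hz⟩
    · exact h.harmonic.add ((h.harmonic_incr.const_mul _).add
        ((T.isHarmonic_sectorDev hz).const_mul _))
    · exact (h.harmonic_incr.const_mul _).add ((T.isHarmonic_sectorDev hz).const_mul _)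
    · intro g hg hs
      have h1 := (h.hasSum g hg hs).add (hsum_e g hg hs)
      refine (congrArg₂ (fun f s => HasSum f s) (funext fun x => ?_) ?_).mpr h1
      · push_cast; ring
      · ring
    · intro x
      rw [T.majorant_of_ne_root c hz, mul_add]
      refine (abs_add_le _ _).trans (add_le_add ?_ ((hF2 x).trans ?_))
      · rw [abs_mul, abs_of_nonneg (by positivity)]
        have h1 : n⁻¹ ≤ 1 := inv_le_one_of_one_le₀ (by linarith)
        calc n⁻¹ * |d x| ≤ 1 * |d x| := by gcongr
          _ ≤ _ := by rw [one_mul]; exact h.le_incr x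
      · refine mul_le_mul_of_nonneg_right ?_ (hI x)
        have : 0 < N⁻¹ := by positivity
        linarith
    · intro x
      have hq1 : (0 : ℝ) < q - 1 := by linarith
      -- Here `n = q + 1` if `v` is the root, but then `d` vanishes.
      have h1 : n⁻¹ * d x = (q : ℝ)⁻¹ * d x := by
        by_cases hvr : v = T.root
        · rw [(h.eq_of_root hvr).1 x]; ring
        · rw [hn, T.card_children v hvr]
      have h2 : k x + e x + e x / ((q : ℝ) - 1) = (k x + d x / ((q : ℝ) - 1)) +
          (q : ℝ) / (q - 1) * (N⁻¹ * T.weight (-c) v * F x) := by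
        simp only [he, h1]
        field_simp
        ring
      rw [h2, T.majorant_of_ne_root c hz, mul_add]
      refine (abs_add_le _ _).trans (add_le_add (h.le_comb x) ?_)
      rw [abs_mul, abs_of_pos (by positivity)]
      have h3 : (q : ℝ) / (q - 1) ≤ 2 := by rw [div_le_iff₀ hq1]; linarith
      calc (q : ℝ) / (q - 1) * |N⁻¹ * T.weight (-c) v * F x| ≤
          2 * (2 * N⁻¹ * (T.weight (-c) v * (T.subtree v).indicator 1 x)) := by
            gcongr; exact hF2 x
        _ = 4 * N⁻¹ * (T.weight (-c) v * (T.subtree v).indicator 1 x) := by ring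
        _ ≤ _ := mul_le_mul_of_nonneg_right hC2 (hI x)
    · intro x hx
      exact le_trans (by positivity) (he0 x hx)
    · intro x hx
      have h1 := h.lower x (T.subtree_subset_subtree_parent z hx)
      have h2 := he0 x hx
      have h3 : 0 ≤ κ * T.weight (-c) v := by positivity
      rw [T.weight_neg_of_ne_root c hz, ← mul_assoc]
      have h4 := mul_le_mul_of_nonneg_right hκ2 hwv.le
      linarith
    · simp only [he, hF, T.sectorDev_root hz, h.incr_apply_root, h.apply_root]
      ring
    · simp only [he, hF, T.sectorDev_root hz, h.incr_apply_root]
      ring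

theorem IsKernelPair.abs_le {T : RegularRootedTree V q} {c C κ : ℝ} {z : V} {k d : V → ℝ}
    (h : T.IsKernelPair c C κ z k d) (x : V) : |k x| ≤ 2 * C * T.majorant c z x := by
  have hq := two_le_cast q
  have h1 : |d x / ((q : ℝ) - 1)| ≤ |d x| := by
    rw [abs_div]
    exact div_le_self (abs_nonneg _) (by rw [abs_of_pos] <;> linarith)
  have h2 := abs_sub (k x + d x / ((q : ℝ) - 1)) (d x / ((q : ℝ) - 1))
  rw [add_sub_cancel_right] at h2
  linarith [h.le_incr x, h.le_comb x]

end RegularRootedTree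

/-! ### Identification with the Bergman kernel -/

namespace HarmonicBergman

section

variable {V : Type*} [MeasurableSpace V] [DiscreteMeasurableSpace V] (X : SimpleGraph V)
  (q : ℕ) (o : V) (α : ℝ)

theorem lintegral_expMeasure (f : V → ℝ≥0∞) :
    ∫⁻ x, f x ∂(expMeasure X q o α) = ∑' x, ENNReal.ofReal (weight X q o α x) * f x := by
  rw [expMeasure, lintegral_withDensity_eq_lintegral_mul _ (Measurable.of_discrete)
    Measurable.of_discrete, lintegral_count]
  rfl

theorem isFiniteMeasure_expMeasure (h : Summable (weight X q o α)) :
    IsFiniteMeasure (expMeasure X q o α) := by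
  refine ⟨?_⟩
  rw [← lintegral_one, lintegral_expMeasure]
  simp only [mul_one]
  exact lt_top_iff_ne_top.2 h.tsum_ofReal_ne_top

variable [q.AtLeastTwo]

theorem integrable_expMeasure_iff (f : V → ℂ) :
    Integrable f (expMeasure X q o α) ↔ Summable fun x => f x * (weight X q o α x : ℂ) := by
  rw [expMeasure, integrable_withDensity_iff_integrable_smul' Measurable.of_discrete
    (Filter.Eventually.of_forall fun x => ENNReal.ofReal_lt_top), integrable_count_iff,
    summable_norm_iff]
  refine summable_congr fun x => ?_
  rw [ENNReal.toReal_ofReal (weight_pos X q o α x).le, Complex.real_smul, mul_comm]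

theorem integral_expMeasure [Countable V] {f : V → ℂ} (hf : Integrable f (expMeasure X q o α)) :
    ∫ x, f x ∂(expMeasure X q o α) = ∑' x, f x * (weight X q o α x : ℂ) := by
  rw [integral_countable hf]
  refine tsum_congr fun x => ?_
  rw [measureReal_def, expMeasure_singleton, ENNReal.toReal_ofReal (weight_pos X q o α x).le,
    Complex.real_smul, mul_comm]

end

variable {V : Type*} {X : SimpleGraph V} [X.LocallyFinite] (hTree : X.IsTree) {q : ℕ}
  (hReg : X.IsRegularOfDegree (q + 1)) (o : V)

theorem isHarmonic_iff (f : V → ℂ) :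
    IsHarmonic X q f ↔ (hTree.toRegularRootedTree hReg o).IsHarmonic f := by
  refine forall_congr' fun x => ?_
  have h : ((q : ℂ) + 1) ≠ 0 := by exact_mod_cast q.succ_ne_zero
  rw [hTree.sum_neighborFinset hReg o, one_div, eq_inv_mul_iff_mul_eq₀ h]
  rfl

variable [MeasurableSpace V] [DiscreteMeasurableSpace V] [q.AtLeastTwo]

/-- A bounded harmonic `k` lies in the Bergman space because the measure is finite; for the same
reason `L²` functions are integrable, so the representation hypothesis applies to every element of
the space. As `k` is real, the conjugation in the inner product has no effect. -/
theorem bergmanKernel_eq {c : ℝ} (hc : 1 < c) {k : V → ℝ} {R : ℝ} (hR : ∀ x, |k x| ≤ R)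
    (hk : (hTree.toRegularRootedTree hReg o).IsHarmonic k) {z : V}
    (hrep : ∀ g : V → ℂ, (hTree.toRegularRootedTree hReg o).IsHarmonic g →
      Summable (fun x => g x * (weight X q o c x : ℂ)) →
      HasSum (fun x => g x * ((k x * weight X q o c x : ℝ) : ℂ)) (g z)) (x : V) :
    bergmanKernel X q o c z x = k x := by
  set T := hTree.toRegularRootedTree hReg o
  have := T.countable
  have := isFiniteMeasure_expMeasure X q o c (T.summable_weight hc)
  have hmem : MemLp (fun x => (k x : ℂ)) 2 (expMeasure X q o c) := by
    refine MemLp.of_bound Measurable.of_discrete.aestronglyMeasurable R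
      (Filter.Eventually.of_forall fun x => ?_)
    rw [Complex.norm_real]
    exact hR x
  have hcoe : ∀ x, hmem.toLp _ x = (k x : ℂ) := forall_of_ae X q o c hmem.coeFn_toLp
  have hB : hmem.toLp _ ∈ bergmanSpace X q o c := by
    rw [mem_bergmanSpace, isHarmonic_iff hTree hReg o, funext hcoe]
    exact hk.ofReal
  have hker : (⟨hmem.toLp _, hB⟩ : bergmanSpace X q o c) =
      RKHS.kerFun (bergmanSpace X q o c) z (1 : ℂ) := by
    refine ext_inner_right ℂ fun g => ?_
    rw [RKHS.kerFun_inner, Submodule.coe_inner, L2.inner_def]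
    have hg : T.IsHarmonic (g : Lp ℂ 2 (expMeasure X q o c)) :=
      (isHarmonic_iff hTree hReg o _).1 g.2
    have hint : Integrable (g : Lp ℂ 2 (expMeasure X q o c)) (expMeasure X q o c) :=
      (Lp.memLp _).integrable (by norm_num)
    have hs := hrep _ hg ((integrable_expMeasure_iff X q o c _).1 hint)
    have hterm : ∀ x, inner ℂ (hmem.toLp _ x) ((g : Lp ℂ 2 (expMeasure X q o c)) x) *
        (weight X q o c x : ℂ) =
        (g : Lp ℂ 2 (expMeasure X q o c)) x * ((k x * weight X q o c x : ℝ) : ℂ) := fun x => by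
      rw [hcoe, RCLike.inner_apply, Complex.conj_ofReal]
      push_cast
      ring
    rw [integral_expMeasure X q o c (L2.integrable_inner _ _), tsum_congr hterm, hs.tsum_eq,
      RCLike.inner_apply, map_one, mul_one]
    rfl
  rw [← hcoe x, bergmanKernel, ← RKHS.kerFun_apply, ← hker]
  rfl

/-- The upper bound serves sufficiency; the lower bounds on the diagonal, on the row and on the
column of `o` serve the three necessary conditions. With one variable at `o` the kernel is the
reciprocal of the total mass. -/
theorem exists_norm_bergmanKernel_bounds {c : ℝ} (hc : 1 < c) :
    ∃ C κ : ℝ, 0 < C ∧ 0 < κ ∧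
      (∀ z x, ‖bergmanKernel X q o c z x‖ ≤
        C * (hTree.toRegularRootedTree hReg o).majorant c z x) ∧
      (∀ x, κ * weight X q o (-c) x ≤ ‖bergmanKernel X q o c x x‖) ∧
      (∀ x, κ ≤ ‖bergmanKernel X q o c o x‖) ∧ ∀ z, κ ≤ ‖bergmanKernel X q o c z o‖ := by
  set T := hTree.toRegularRootedTree hReg o
  obtain ⟨C, κ, hC, hκ, h⟩ := T.exists_isKernelPair hc
  choose k d hkd using h
  have hM := T.mass_pos hc
  have hker : ∀ z x, bergmanKernel X q o c z x = k z x := fun z x =>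
    bergmanKernel_eq hTree hReg o hc (k := k z)
      (R := 2 * C * (1 + ∑ i ∈ Finset.range (T.level z), T.weight (-c) (T.parent^[i + 1] z)))
      (fun x => ((hkd z).abs_le x).trans
        (mul_le_mul_of_nonneg_left (T.majorant_le c z x) (by positivity)))
      (hkd z).harmonic (hkd z).hasSum x
  have hnorm : ∀ z x, ‖bergmanKernel X q o c z x‖ = |k z x| := fun z x => by
    rw [hker, Complex.norm_real, Real.norm_eq_abs]
  refine ⟨2 * C, min κ (T.mass c)⁻¹, by positivity, by positivity, fun z x => ?_, fun x => ?_,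
    fun x => ?_, fun z => ?_⟩
  · rw [hnorm]
    exact (hkd z).abs_le x
  · rw [hnorm]
    refine le_trans ?_ (((hkd x).lower x (T.mem_subtree_self x)).trans (le_abs_self _))
    exact mul_le_mul_of_nonneg_right (min_le_left _ _) (weight_pos X q o _ x).le
  · rw [hnorm, ((hkd o).eq_of_root rfl).2 x]
    exact (min_le_right _ _).trans (le_abs_self _)
  · have h1 : k z o = (T.mass c)⁻¹ := (hkd z).apply_root
    rw [hnorm, h1]
    exact (min_le_right _ _).trans (le_abs_self _)

end HarmonicBergman

/-! ### Schur's test -/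

theorem ENNReal.tsum_mul_le_weight_mul_Lp {ι : Type*} {p : ℝ} (hp : 1 ≤ p) (w f : ι → ℝ≥0∞) :
    (∑' i, w i * f i) ^ p ≤ (∑' i, w i) ^ (p - 1) * ∑' i, w i * f i ^ p := by
  have hp0 : 0 < p := by linarith
  have h1 : ∑' i, w i * f i ≤ (∑' i, w i) ^ (1 - p⁻¹) * (∑' i, w i * f i ^ p) ^ p⁻¹ := by
    rw [ENNReal.tsum_eq_iSup_sum]
    refine iSup_le fun s => (ENNReal.inner_le_weight_mul_Lp_of_nonneg s hp w f).trans ?_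
    have hp1 : p⁻¹ ≤ 1 := inv_le_one_of_one_le₀ hp
    have hp2 : 0 ≤ 1 - p⁻¹ := by linarith
    gcongr <;> exact ENNReal.sum_le_tsum s
  calc (∑' i, w i * f i) ^ p ≤ ((∑' i, w i) ^ (1 - p⁻¹) * (∑' i, w i * f i ^ p) ^ p⁻¹) ^ p := by
        gcongr
    _ = _ := by
        rw [ENNReal.mul_rpow_of_nonneg _ _ hp0.le, ← ENNReal.rpow_mul, ← ENNReal.rpow_mul,
          inv_mul_cancel₀ hp0.ne', ENNReal.rpow_one]
        congr 2
        field_simp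

/-- **Schur's test** for a nonnegative kernel on a discrete weighted space. -/
theorem ENNReal.schur_test {ι : Type*} {p : ℝ} (hp : 1 ≤ p) {H : ι → ι → ℝ≥0∞} {u w : ι → ℝ≥0∞}
    (hu0 : ∀ x, u x ≠ 0) (hu : ∀ x, u x ≠ ⊤) {C₁ C₂ : ℝ≥0∞}
    (h₁ : ∀ z, ∑' x, H z x * u x ≤ C₁ * u z)
    (h₂ : ∀ x, ∑' z, H z x * (w z * u z ^ (p - 1)) ≤ C₂ * (w x * u x ^ (p - 1)))
    (F : ι → ℝ≥0∞) :
    ∑' z, w z * (∑' x, H z x * F x) ^ p ≤ C₁ ^ (p - 1) * C₂ * ∑' x, w x * F x ^ p := by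
  have hp0 : 0 < p := by linarith
  -- This is `F^p u^(1-p)`, in the form produced by Hölder's inequality with weight `H z x * u x`
  -- applied to `F / u`.
  set v : ι → ℝ≥0∞ := fun x => u x * (F x / u x) ^ p with hv
  have hv' : ∀ x, v x * u x ^ (p - 1) = F x ^ p := fun x => by
    have h1 : u x * u x ^ (p - 1) = u x ^ p := by
      conv_lhs => rw [← ENNReal.rpow_one (u x), ← ENNReal.rpow_mul, one_mul]
      rw [← ENNReal.rpow_add _ _ (hu0 x) (hu x)]
      congr 1; ring
    rw [hv, mul_right_comm, h1, ← ENNReal.mul_rpow_of_nonneg _ _ hp0.le,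
      ENNReal.mul_div_cancel (hu0 x) (hu x)]
  have hz : ∀ z, (∑' x, H z x * F x) ^ p ≤
      C₁ ^ (p - 1) * u z ^ (p - 1) * ∑' x, H z x * v x := fun z => by
    have h1 : ∀ x, H z x * F x = H z x * u x * (F x / u x) := fun x => by
      rw [mul_assoc, ENNReal.mul_div_cancel (hu0 x) (hu x)]
    have h2 : ∀ x, H z x * v x = H z x * u x * (F x / u x) ^ p := fun x => by
      rw [mul_assoc]
    simp only [h1, h2]
    refine (ENNReal.tsum_mul_le_weight_mul_Lp hp _ _).trans ?_
    gcongr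
    rw [← ENNReal.mul_rpow_of_nonneg _ _ (by linarith)]
    exact ENNReal.rpow_le_rpow (h₁ z) (by linarith)
  calc ∑' z, w z * (∑' x, H z x * F x) ^ p
      ≤ ∑' z, w z * (C₁ ^ (p - 1) * u z ^ (p - 1) * ∑' x, H z x * v x) := by
        gcongr with z; exact hz z
    _ = C₁ ^ (p - 1) * ∑' z, ∑' x, v x * (H z x * (w z * u z ^ (p - 1))) := by
        rw [← ENNReal.tsum_mul_left]
        refine tsum_congr fun z => ?_
        rw [← ENNReal.tsum_mul_left, ← ENNReal.tsum_mul_left, ← ENNReal.tsum_mul_left]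
        refine tsum_congr fun x => ?_
        ring
    _ = C₁ ^ (p - 1) * ∑' x, v x * ∑' z, H z x * (w z * u z ^ (p - 1)) := by
        rw [ENNReal.tsum_comm]
        simp only [ENNReal.tsum_mul_left]
    _ ≤ C₁ ^ (p - 1) * ∑' x, v x * (C₂ * (w x * u x ^ (p - 1))) := by
        gcongr with x; exact h₂ x
    _ = _ := by
        rw [mul_assoc, ← ENNReal.tsum_mul_left (a := C₂)]
        congr 1
        refine tsum_congr fun x => ?_
        rw [← hv' x]
        ring

/-! ### Boundedness of the kernel summed over common ancestors -/

namespace RegularRootedTree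

section

variable {V : Type*} {q : ℕ} (T : RegularRootedTree V q)

/-- The function `q ^ (-s (|x| - |y|))` of the descendants `x` of `y`. -/
noncomputable def decay (s : ℝ) (y x : V) : ℝ≥0∞ :=
  (T.subtree y).indicator (fun x => ENNReal.ofReal (T.weight s x * T.weight (-s) y)) x

/-- The kernel that combines the decay of both variables over their common ancestors. -/
noncomputable def treeKernel (a b : ℝ) (z x : V) : ℝ≥0∞ := ∑' y, T.decay a y z * T.decay b y x

theorem treeKernel_swap (a b : ℝ) (z x : V) : T.treeKernel a b z x = T.treeKernel b a x z :=
  tsum_congr fun _ => mul_comm _ _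

theorem treeKernel_eq_sum (a b : ℝ) (z x : V) :
    T.treeKernel a b z x = ∑ i ∈ Finset.range (T.level z + 1),
      ENNReal.ofReal (T.weight a z * T.weight (-a) (T.parent^[i] z)) *
        T.decay b (T.parent^[i] z) x := by
  rw [← T.tsum_ancestors z fun y => ENNReal.ofReal (T.weight a z * T.weight (-a) y) * T.decay b y x]
  refine tsum_congr fun y => ?_
  rw [decay]
  by_cases hz : z ∈ T.subtree y
  · rw [Set.indicator_of_mem hz, Set.indicator_of_mem hz]
  · rw [Set.indicator_of_notMem hz, Set.indicator_of_notMem hz, zero_mul]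

end

variable {V : Type*} {q : ℕ} [q.AtLeastTwo] (T : RegularRootedTree V q)

theorem weight_of_level_eq_add (s : ℝ) {x y : V} {k : ℕ} (h : T.level x = T.level y + k) :
    T.weight s x = T.weight s y * (q : ℝ) ^ (-s * (k : ℝ)) := by
  rw [weight, weight, h, ← Real.rpow_add (cast_pos q)]
  push_cast
  congr 1; ring

/-- The sum of a geometric series over the generations of a branch. -/
noncomputable def generationSum (q : ℕ) (s : ℝ) : ℝ≥0∞ :=
  ∑' k : ℕ, ENNReal.ofReal ((q : ℝ) ^ k * (q : ℝ) ^ (s * k))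

theorem generationSum_ne_top {s : ℝ} (hs : s < -1) : generationSum q s ≠ ⊤ :=
  (tsum_ofReal_ne_top_iff fun _ => by positivity).2 ((summable_pow_mul_rpow_iff s).2 hs)

/-- Generation `k` below `y` has at most `2 q^k` vertices, each contributing `q^((s-b)k)` times the
value at `y`. -/
theorem tsum_decay_mul_le (b s : ℝ) (y : V) :
    ∑' x, T.decay b y x * ENNReal.ofReal (T.weight (-s) x) ≤
      2 * generationSum q (s - b) * ENNReal.ofReal (T.weight (-s) y) := by
  have hq := cast_pos q
  have h1 : ∀ x, T.decay b y x * ENNReal.ofReal (T.weight (-s) x) = (T.subtree y).indicator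
      (fun x => ENNReal.ofReal (T.weight b x * T.weight (-b) y) * ENNReal.ofReal (T.weight (-s) x))
      x := fun x => by
    rw [decay]
    by_cases hx : x ∈ T.subtree y
    · rw [Set.indicator_of_mem hx, Set.indicator_of_mem hx]
    · rw [Set.indicator_of_notMem hx, Set.indicator_of_notMem hx, zero_mul]
  rw [tsum_congr h1, tsum_indicator_subtree, generationSum, ← ENNReal.tsum_mul_left,
    ← ENNReal.tsum_mul_right]
  refine ENNReal.tsum_le_tsum fun k => ?_
  have h2 : ∀ x ∈ T.desc k y, ENNReal.ofReal (T.weight b x * T.weight (-b) y) *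
      ENNReal.ofReal (T.weight (-s) x) =
      ENNReal.ofReal ((q : ℝ) ^ ((s - b) * k) * T.weight (-s) y) := fun x hx => by
    have hl := T.level_of_mem_desc hx
    have hw := T.weight_pos
    rw [← ENNReal.ofReal_mul (mul_nonneg (hw _ _).le (hw _ _).le)]
    congr 1
    rw [T.weight_of_level_eq_add b hl, T.weight_of_level_eq_add (-s) hl]
    have h3 : (q : ℝ) ^ ((s - b) * k) = (q : ℝ) ^ (-b * (k : ℝ)) * (q : ℝ) ^ (-(-s) * (k : ℝ)) := by
      rw [← Real.rpow_add hq]; congr 1; ring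
    rw [h3]
    linear_combination (q : ℝ) ^ (-b * (k : ℝ)) * (q : ℝ) ^ (-(-s) * (k : ℝ)) * T.weight (-s) y *
      T.weight_mul_weight_neg b y
  rw [Finset.sum_congr rfl h2, Finset.sum_const, nsmul_eq_mul, ENNReal.ofReal_mul (by positivity),
    ENNReal.ofReal_mul (by positivity), ENNReal.ofReal_pow (by positivity), ENNReal.ofReal_natCast,
    ← mul_assoc, ← mul_assoc]
  gcongr
  exact_mod_cast T.card_desc_le y k

/-- Summing over `x` first leaves a geometric series in `q^(-(a+s))` over the ancestors of `z`. The
`-1` in the argument of `generationSum` cancels its factor `q^k`, as there is a single ancestor per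
generation. -/
theorem tsum_treeKernel_mul_le (a b s : ℝ) (z : V) :
    ∑' x, T.treeKernel a b z x * ENNReal.ofReal (T.weight (-s) x) ≤
      2 * generationSum q (s - b) * generationSum q (-1 - (a + s)) *
        ENNReal.ofReal (T.weight (-s) z) := by
  have hq := cast_pos q
  have h1 : ∀ x, T.treeKernel a b z x * ENNReal.ofReal (T.weight (-s) x) =
      ∑ i ∈ Finset.range (T.level z + 1),
        ENNReal.ofReal (T.weight a z * T.weight (-a) (T.parent^[i] z)) *
          (T.decay b (T.parent^[i] z) x * ENNReal.ofReal (T.weight (-s) x)) := fun x => by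
    rw [treeKernel_eq_sum, Finset.sum_mul]
    exact Finset.sum_congr rfl fun i _ => mul_assoc _ _ _
  rw [tsum_congr h1, Summable.tsum_finsetSum fun _ _ => ENNReal.summable]
  simp only [ENNReal.tsum_mul_left]
  have h2 : ∀ i ∈ Finset.range (T.level z + 1),
      ENNReal.ofReal (T.weight a z * T.weight (-a) (T.parent^[i] z)) *
        ∑' x, T.decay b (T.parent^[i] z) x * ENNReal.ofReal (T.weight (-s) x) ≤
      2 * generationSum q (s - b) * ENNReal.ofReal (T.weight (-s) z) *
        ENNReal.ofReal ((q : ℝ) ^ i * (q : ℝ) ^ ((-1 - (a + s)) * i)) := fun i hi => by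
    have hl : T.level z = T.level (T.parent^[i] z) + i := by
      rw [T.level_iterate_parent]
      rw [Finset.mem_range] at hi
      omega
    refine (mul_le_mul_right (T.tsum_decay_mul_le b s _) _).trans_eq ?_
    rw [mul_left_comm, mul_assoc (2 * generationSum q (s - b))]
    have hw := T.weight_pos
    rw [← ENNReal.ofReal_mul (mul_nonneg (hw _ _).le (hw _ _).le), ← ENNReal.ofReal_mul (hw _ _).le]
    congr 2
    rw [T.weight_of_level_eq_add a hl, T.weight_of_level_eq_add (-s) hl]
    have h3 : (q : ℝ) ^ (-a * (i : ℝ)) = (q : ℝ) ^ (-(-s) * (i : ℝ)) *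
        ((q : ℝ) ^ i * (q : ℝ) ^ ((-1 - (a + s)) * i)) := by
      rw [← Real.rpow_natCast, ← Real.rpow_add hq, ← Real.rpow_add hq]; congr 1; ring
    rw [h3]
    linear_combination (q : ℝ) ^ (-(-s) * (i : ℝ)) *
      ((q : ℝ) ^ i * (q : ℝ) ^ ((-1 - (a + s)) * i)) * T.weight (-s) (T.parent^[i] z) *
      T.weight_mul_weight_neg a (T.parent^[i] z)
  refine (Finset.sum_le_sum h2).trans ?_
  rw [← Finset.mul_sum, mul_assoc _ (generationSum q (-1 - (a + s))),
    mul_comm (generationSum q (-1 - (a + s))), ← mul_assoc]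
  gcongr
  exact ENNReal.sum_le_tsum _

theorem exists_treeKernel_bound {α p a b : ℝ} (hp : 1 < p) (hab : 1 < a + b)
    (ha : -(p * a) < α - 1) (hb : α - 1 < p * (b - 1)) :
    ∃ B : ℝ≥0∞, B ≠ ⊤ ∧ ∀ F : V → ℝ≥0∞,
      ∑' z, ENNReal.ofReal (T.weight α z) * (∑' x, T.treeKernel a b z x * F x) ^ p ≤
        B * ∑' x, ENNReal.ofReal (T.weight α x) * F x ^ p := by
  have hp1 : 0 < p - 1 := by linarith
  -- The four bounds on `s` are the convergence conditions of the four geometric series in the two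
  -- Schur inequalities. Comparing each lower with each upper bound gives exactly `1 < a + b`
  -- (twice), `ha` and `hb`.
  obtain ⟨s, hs1, hs2⟩ : ∃ s, max (-a) ((α - b) / (p - 1)) < s ∧
      s < min (b - 1) ((a + α - 1) / (p - 1)) := by
    refine exists_between (max_lt (lt_min ?_ ?_) (lt_min ?_ ?_))
    · linarith
    · rw [lt_div_iff₀ hp1]; linarith
    · rw [div_lt_iff₀ hp1]; linarith
    · exact div_lt_div_of_pos_right (by linarith) hp1
  obtain ⟨hs1, hs3⟩ := max_lt_iff.1 hs1
  obtain ⟨hs2, hs4⟩ := lt_min_iff.1 hs2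
  rw [div_lt_iff₀ hp1] at hs3
  rw [lt_div_iff₀ hp1] at hs4
  -- The weight times `u^(p-1)` is `q^(r|x|)`, so the second Schur inequality is the first with `a`
  -- and `b` exchanged and `s` replaced by `r`.
  set r := s * (p - 1) - α with hr
  have hw := T.weight_pos
  have hwr : ∀ x, ENNReal.ofReal (T.weight α x) * ENNReal.ofReal (T.weight (-s) x) ^ (p - 1) =
      ENNReal.ofReal (T.weight (-r) x) := fun x => by
    rw [ENNReal.ofReal_rpow_of_pos (hw _ _), ← ENNReal.ofReal_mul (hw _ _).le]
    congr 1
    rw [weight, weight, weight, ← Real.rpow_mul (cast_pos q).le, ← Real.rpow_add (cast_pos q), hr]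
    congr 1; ring
  refine ⟨_, ?_, ENNReal.schur_test hp.le (u := fun x => ENNReal.ofReal (T.weight (-s) x))
    (fun x => (ENNReal.ofReal_pos.2 (hw _ _)).ne') (fun x => ENNReal.ofReal_ne_top)
    (T.tsum_treeKernel_mul_le a b s) (C₂ := 2 * generationSum q (r - a) *
      generationSum q (-1 - (b + r))) fun x => ?_⟩
  · have htop {t : ℝ} (ht : t < -1) : generationSum q t ≠ ⊤ := generationSum_ne_top ht
    have h2 : (2 : ℝ≥0∞) ≠ ⊤ := by simp
    refine ENNReal.mul_ne_top (ENNReal.rpow_ne_top_of_nonneg hp1.le ?_) ?_ <;>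
    exact ENNReal.mul_ne_top (ENNReal.mul_ne_top h2 (htop (by linarith))) (htop (by linarith))
  · simp only [hwr]
    rw [tsum_congr fun z => by rw [T.treeKernel_swap]]
    exact T.tsum_treeKernel_mul_le b a r x

/-- For each common ancestor `y`, `q^(c|y|) ≤ q^(a|y|) q^(b|y|)`, and the two factors turn the
weights of `z` and `x` into decay away from `y`. -/
theorem ofReal_majorant_le {a b c : ℝ} (h : c ≤ a + b) (z x : V) :
    ENNReal.ofReal (T.weight a z * T.majorant c z x * T.weight b x) ≤
      2 * T.treeKernel a b z x := by
  have hw := T.weight_pos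
  have hI : ∀ y, (0 : ℝ) ≤ (T.subtree y).indicator 1 x := fun y =>
    Set.indicator_nonneg (fun _ _ => zero_le_one) _
  have h1 : T.weight a z * T.majorant c z x * T.weight b x ≤
      2 * ∑ i ∈ Finset.range (T.level z + 1), T.weight a z * (T.weight (-c) (T.parent^[i] z) *
        (T.subtree (T.parent^[i] z)).indicator 1 x) * T.weight b x := by
    rw [← Finset.sum_mul, ← Finset.mul_sum, ← mul_assoc, mul_left_comm]
    exact mul_le_mul_of_nonneg_right
      (mul_le_mul_of_nonneg_left (T.majorant_le_two_mul c z x) (hw _ _).le) (hw _ _).le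
  refine (ENNReal.ofReal_le_ofReal h1).trans ?_
  rw [ENNReal.ofReal_mul (by norm_num), ENNReal.ofReal_ofNat, ENNReal.ofReal_sum_of_nonneg
    fun i _ => mul_nonneg (mul_nonneg (hw _ _).le (mul_nonneg (hw _ _).le (hI _))) (hw _ _).le,
    treeKernel_eq_sum]
  gcongr with i
  set y := T.parent^[i] z
  rw [decay]
  by_cases hx : x ∈ T.subtree y
  · rw [Set.indicator_of_mem hx, Set.indicator_of_mem hx,
      ← ENNReal.ofReal_mul (mul_nonneg (hw _ _).le (hw _ _).le)]
    refine ENNReal.ofReal_le_ofReal ?_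
    have h2 : T.weight (-c) y ≤ T.weight (-a) y * T.weight (-b) y := by
      rw [weight, weight, weight, ← Real.rpow_add (cast_pos q)]
      refine Real.rpow_le_rpow_of_exponent_le (by have := two_le_cast q; linarith) ?_
      have : (0 : ℝ) ≤ T.level y := Nat.cast_nonneg _
      nlinarith
    calc T.weight a z * (T.weight (-c) y * (1 : V → ℝ) x) * T.weight b x =
        T.weight a z * T.weight b x * T.weight (-c) y := by rw [Pi.one_apply]; ring
      _ ≤ T.weight a z * T.weight b x * (T.weight (-a) y * T.weight (-b) y) :=
          mul_le_mul_of_nonneg_left h2 (mul_nonneg (hw _ _).le (hw _ _).le)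
      _ = _ := by ring
  · rw [Set.indicator_of_notMem hx]
    simp

end RegularRootedTree

/-! ### Domination and test functions for integral operators -/

namespace HarmonicBergman

theorem norm_weightedOp_single {V : Type*} (X : SimpleGraph V) (q : ℕ) [q.AtLeastTwo] (o : V)
    [DecidableEq V] (k : V → V → ℂ) (a b : ℝ) (y z : V) :
    ‖weightedOp X q o k a b (Pi.single y 1) z‖ =
      weight X q o a z * ‖k z y‖ * weight X q o b y := by
  rw [weightedOp, tsum_eq_single y fun x hx => by rw [Pi.single_eq_of_ne hx]; simp,
    Pi.single_eq_same, mul_one, norm_mul, norm_mul, Complex.norm_real, Complex.norm_real,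
    Real.norm_of_nonneg (weight_pos X q o _ _).le, Real.norm_of_nonneg (weight_pos X q o _ _).le,
    mul_assoc]

section

variable {V : Type*} [MeasurableSpace V] [DiscreteMeasurableSpace V] (X : SimpleGraph V)
  (q : ℕ) (o : V)

theorem eLpNorm_expMeasure_rpow (α : ℝ) {p : ℝ} (hp : 0 < p) (f : V → ℂ) :
    eLpNorm f (ENNReal.ofReal p) (expMeasure X q o α) ^ p =
      ∑' x, ENNReal.ofReal (weight X q o α x) * ‖f x‖ₑ ^ p := by
  rw [eLpNorm_eq_lintegral_rpow_enorm_toReal (by simpa using hp) ENNReal.ofReal_ne_top,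
    ENNReal.toReal_ofReal hp.le, lintegral_expMeasure, ← ENNReal.rpow_mul, one_div,
    inv_mul_cancel₀ hp.ne', ENNReal.rpow_one]

variable [q.AtLeastTwo]

theorem memLp_expMeasure_iff (α : ℝ) {p : ℝ} (hp : 0 < p) (f : V → ℂ) :
    MemLp f (ENNReal.ofReal p) (expMeasure X q o α) ↔
      Summable fun x => weight X q o α x * ‖f x‖ ^ p := by
  have hw := weight_pos X q o α
  have h1 : ∀ x, ENNReal.ofReal (weight X q o α x * ‖f x‖ ^ p) =
      ENNReal.ofReal (weight X q o α x) * ‖f x‖ₑ ^ p := fun x => by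
    rw [ENNReal.ofReal_mul (hw x).le, ← ofReal_norm,
      ENNReal.ofReal_rpow_of_nonneg (norm_nonneg _) hp.le]
  rw [← RegularRootedTree.tsum_ofReal_ne_top_iff fun x =>
    mul_nonneg (hw x).le (Real.rpow_nonneg (norm_nonneg _) _)]
  simp only [h1]
  rw [← eLpNorm_expMeasure_rpow X q o α hp, MemLp,
    and_iff_right Measurable.of_discrete.aestronglyMeasurable, ← lt_top_iff_ne_top,
    ENNReal.rpow_lt_top_iff_of_pos hp]

variable {X q o}

/-- The operator with kernel `|k|` applied to `|f|` dominates the operator with kernel `k` applied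
to `f`, and `|f|` has the norm of `f`. -/
theorem IsBoundedOnLp.of_norm {α p a b : ℝ} {k : V → V → ℂ}
    (h : IsBoundedOnLp X q o α p (fun z x => (‖k z x‖ : ℂ)) a b) :
    IsBoundedOnLp X q o α p k a b := by
  obtain ⟨C, hC⟩ := h
  refine ⟨C, fun f hf => ?_⟩
  have hw := weight_pos X q o
  have hn : ∀ z x, (‖k z x‖ : ℂ) * ((‖f x‖ : ℝ) : ℂ) * (weight X q o b x : ℂ) =
      ((‖k z x * f x * (weight X q o b x : ℂ)‖ : ℝ) : ℂ) := fun z x => by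
    rw [norm_mul, norm_mul, Complex.norm_real, Real.norm_of_nonneg (hw b x).le]
    push_cast
    rfl
  have hf' : MemLp (fun x => ((‖f x‖ : ℝ) : ℂ)) (ENNReal.ofReal p) (expMeasure X q o α) :=
    hf.norm.ofReal
  obtain ⟨h1, h2, h3⟩ := hC _ hf'
  have hs : ∀ z, Summable fun x => ‖k z x * f x * (weight X q o b x : ℂ)‖ := fun z => by
    have := h1 z
    simp only [hn] at this
    exact Complex.summable_ofReal.1 this
  have hle : ∀ z, ‖weightedOp X q o k a b f z‖ ≤
      ‖weightedOp X q o (fun z x => (‖k z x‖ : ℂ)) a b (fun x => ((‖f x‖ : ℝ) : ℂ)) z‖ := fun z => by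
    rw [weightedOp, weightedOp, tsum_congr (hn z), ← Complex.ofReal_tsum, norm_mul, norm_mul,
      Complex.norm_real (∑' x, _), Real.norm_of_nonneg (tsum_nonneg fun x => norm_nonneg _)]
    gcongr
    exact norm_tsum_le_tsum_norm (hs z)
  have hm : eLpNorm (weightedOp X q o k a b f) (ENNReal.ofReal p) (expMeasure X q o α) ≤ _ :=
    eLpNorm_mono hle
  refine ⟨fun z => (hs z).of_norm, h2.mono Measurable.of_discrete.aestronglyMeasurable
    (Filter.Eventually.of_forall hle), hm.trans (h3.trans_eq ?_)⟩
  congr 1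
  exact eLpNorm_congr_norm_ae (Filter.Eventually.of_forall fun x => by simp)

theorem isBoundedOnLp_of_majorant {α p a b : ℝ} (hp : 0 < p) {k : V → V → ℂ} {H : V → V → ℝ≥0∞}
    {D B : ℝ≥0∞} (hD : D ≠ ⊤) (hB : B ≠ ⊤)
    (hk : ∀ z x, ENNReal.ofReal (weight X q o a z * ‖k z x‖ * weight X q o b x) ≤ D * H z x)
    (hH : ∀ F : V → ℝ≥0∞, ∑' z, ENNReal.ofReal (weight X q o α z) * (∑' x, H z x * F x) ^ p ≤
      B * ∑' x, ENNReal.ofReal (weight X q o α x) * F x ^ p) :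
    IsBoundedOnLp X q o α p k a b := by
  have hw := weight_pos X q o
  refine ⟨(D * B ^ p⁻¹).toNNReal, fun f hf => ?_⟩
  rw [ENNReal.coe_toNNReal (ENNReal.mul_ne_top hD (ENNReal.rpow_ne_top_of_nonneg (by positivity) hB))]
  have hterm : ∀ z x, ENNReal.ofReal (weight X q o a z) *
      ‖k z x * f x * (weight X q o b x : ℂ)‖ₑ ≤ D * (H z x * ‖f x‖ₑ) := fun z x => by
    have h1 : ENNReal.ofReal (weight X q o a z) * ‖k z x * f x * (weight X q o b x : ℂ)‖ₑ =
        ENNReal.ofReal (weight X q o a z * ‖k z x‖ * weight X q o b x) * ‖f x‖ₑ := by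
      rw [← ofReal_norm, ← ofReal_norm, ← ENNReal.ofReal_mul (hw a z).le,
        ← ENNReal.ofReal_mul (mul_nonneg (mul_nonneg (hw a z).le (norm_nonneg _)) (hw b x).le),
        norm_mul, norm_mul, Complex.norm_real, Real.norm_of_nonneg (hw b x).le]
      congr 1; ring
    rw [h1, ← mul_assoc]
    gcongr
    exact hk z x
  have hsum : ∀ z, ENNReal.ofReal (weight X q o a z) *
      ∑' x, ‖k z x * f x * (weight X q o b x : ℂ)‖ₑ ≤ D * ∑' x, H z x * ‖f x‖ₑ := fun z => by
    rw [← ENNReal.tsum_mul_left, ← ENNReal.tsum_mul_left]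
    exact ENNReal.tsum_le_tsum (hterm z)
  have hfin : B * ∑' x, ENNReal.ofReal (weight X q o α x) * ‖f x‖ₑ ^ p ≠ ⊤ := by
    rw [← eLpNorm_expMeasure_rpow X q o α hp]
    exact ENNReal.mul_ne_top hB (ENNReal.rpow_ne_top_of_nonneg hp.le hf.eLpNorm_ne_top)
  have hle : eLpNorm (weightedOp X q o k a b f) (ENNReal.ofReal p) (expMeasure X q o α) ≤
      D * B ^ p⁻¹ * eLpNorm f (ENNReal.ofReal p) (expMeasure X q o α) := by
    rw [← ENNReal.rpow_le_rpow_iff hp, ENNReal.mul_rpow_of_nonneg _ _ hp.le,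
      ENNReal.mul_rpow_of_nonneg _ _ hp.le, ← ENNReal.rpow_mul, inv_mul_cancel₀ hp.ne',
      ENNReal.rpow_one, eLpNorm_expMeasure_rpow X q o α hp, eLpNorm_expMeasure_rpow X q o α hp,
      mul_assoc]
    refine le_trans ?_ (mul_le_mul_right (hH fun x => ‖f x‖ₑ) _)
    rw [← ENNReal.tsum_mul_left]
    refine ENNReal.tsum_le_tsum fun z => ?_
    rw [mul_left_comm, ← ENNReal.mul_rpow_of_nonneg _ _ hp.le]
    gcongr
    refine le_trans ?_ (hsum z)
    rw [weightedOp, enorm_mul, ← ofReal_norm, Complex.norm_real,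
      Real.norm_of_nonneg (hw a z).le]
    gcongr
    exact enorm_tsum_le_tsum_enorm
  have hne : D * B ^ p⁻¹ * eLpNorm f (ENNReal.ofReal p) (expMeasure X q o α) ≠ ⊤ :=
    ENNReal.mul_ne_top (ENNReal.mul_ne_top hD (ENNReal.rpow_ne_top_of_nonneg (by positivity) hB))
      hf.eLpNorm_ne_top
  refine ⟨fun z => ?_, ⟨Measurable.of_discrete.aestronglyMeasurable,
    lt_of_le_of_lt hle hne.lt_top⟩, hle⟩
  -- Absolute convergence at every `z`: since each vertex has positive mass, a divergent series at
  -- one vertex would make the whole `p`-sum infinite.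
  have h1 := ne_top_of_le_ne_top hfin (hH fun x => ‖f x‖ₑ)
  have h2 := ne_top_of_le_ne_top h1 (ENNReal.le_tsum z)
  have hwz : ENNReal.ofReal (weight X q o α z) ≠ 0 := (ENNReal.ofReal_pos.2 (hw α z)).ne'
  have h3 : ∑' x, H z x * ‖f x‖ₑ ≠ ⊤ := fun h => by
    rw [h, ENNReal.top_rpow_of_pos hp, ENNReal.mul_top hwz] at h2
    exact h2 rfl
  have h4 := ne_top_of_le_ne_top (ENNReal.mul_ne_top hD h3) (hsum z)
  have h5 : ∑' x, ‖k z x * f x * (weight X q o b x : ℂ)‖ₑ ≠ ⊤ := fun h => by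
    rw [h, ENNReal.mul_top (ENNReal.ofReal_pos.2 (hw a z)).ne'] at h4
    exact h4 rfl
  simp only [← ofReal_norm] at h5
  exact ((RegularRootedTree.tsum_ofReal_ne_top_iff fun x => norm_nonneg _).1 h5).of_norm

theorem memLp_single (α : ℝ) {p : ℝ} (hp : 0 < p) [DecidableEq V] (y : V) :
    MemLp (Pi.single y (1 : ℂ)) (ENNReal.ofReal p) (expMeasure X q o α) := by
  rw [memLp_expMeasure_iff X q o α hp]
  refine summable_of_ne_finset_zero (s := {y}) fun x hx => ?_
  rw [Pi.single_eq_of_ne (by simpa using hx), norm_zero, Real.zero_rpow hp.ne', mul_zero]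

/-- Testing on point masses: the diagonal of the kernel of a bounded operator is bounded. -/
theorem IsBoundedOnLp.exists_diag_le {α p a b : ℝ} (hp : 0 < p) {k : V → V → ℂ}
    (h : IsBoundedOnLp X q o α p k a b) :
    ∃ C : ℝ, ∀ x, weight X q o a x * ‖k x x‖ * weight X q o b x ≤ C := by
  classical
  obtain ⟨C, hC⟩ := h
  refine ⟨C, fun x => ?_⟩
  have hw := weight_pos X q o α x
  have h1 := ENNReal.rpow_le_rpow (hC _ (memLp_single α hp x)).2.2 hp.le
  rw [ENNReal.mul_rpow_of_nonneg _ _ hp.le, eLpNorm_expMeasure_rpow X q o α hp,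
    eLpNorm_expMeasure_rpow X q o α hp] at h1
  have h2 := (ENNReal.le_tsum x).trans h1
  rw [tsum_eq_single (f := fun y => ENNReal.ofReal (weight X q o α y) *
      ‖(Pi.single x (1 : ℂ) : V → ℂ) y‖ₑ ^ p) x
    fun y hy => by simp [Pi.single_eq_of_ne hy, hp], Pi.single_eq_same, enorm_one,
    ENNReal.one_rpow, mul_one, mul_comm, ENNReal.mul_le_mul_iff_left
      (ENNReal.ofReal_pos.2 hw).ne' ENNReal.ofReal_ne_top, ENNReal.rpow_le_rpow_iff hp,
    ← ofReal_norm, norm_weightedOp_single] at h2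
  exact (ENNReal.ofReal_le_coe).1 h2

end

/-! ### Sufficiency and the three necessary conditions on the tree -/

variable {V : Type*} {X : SimpleGraph V} [X.LocallyFinite] {q : ℕ} (o : V)
variable [MeasurableSpace V] [DiscreteMeasurableSpace V] [q.AtLeastTwo]

theorem sIsBounded (hTree : X.IsTree)
    (hReg : X.IsRegularOfDegree (q + 1)) {α p a b c : ℝ} (hc : 1 < c) (hp : 1 < p)
    (hab : c ≤ a + b) (ha : -(p * a) < α - 1) (hb : α - 1 < p * (b - 1)) :
    SIsBounded X q o α p a b c := by
  set T := hTree.toRegularRootedTree hReg o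
  obtain ⟨B, hB, hH⟩ := T.exists_treeKernel_bound hp (by linarith) ha hb
  obtain ⟨C, -, hC, -, hK, -⟩ := exists_norm_bergmanKernel_bounds hTree hReg o hc
  have hw := weight_pos X q o
  refine isBoundedOnLp_of_majorant (by linarith) (D := ENNReal.ofReal C * 2)
    (ENNReal.mul_ne_top ENNReal.ofReal_ne_top (by simp)) hB (fun z x => ?_) hH
  rw [Complex.norm_real, norm_norm, mul_assoc (ENNReal.ofReal C), mul_assoc (weight X q o a z)]
  refine le_trans ?_ (mul_le_mul_right (T.ofReal_majorant_le hab z x) _)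
  rw [← ENNReal.ofReal_mul hC.le]
  refine ENNReal.ofReal_le_ofReal ?_
  calc weight X q o a z * (‖bergmanKernel X q o c z x‖ * weight X q o b x) ≤
      weight X q o a z * (C * T.majorant c z x * weight X q o b x) :=
        mul_le_mul_of_nonneg_left (mul_le_mul_of_nonneg_right (hK z x) (hw b x).le) (hw a z).le
    _ = C * (weight X q o a z * T.majorant c z x * weight X q o b x) := by ring

/-- The image of the point mass at `o` is at least `κ q^(-a|z|)` in modulus, and it must lie in
`L^p_α`. -/
theorem lt_of_isBoundedOnLp_column (hTree : X.IsTree)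
    (hReg : X.IsRegularOfDegree (q + 1)) {α p a b κ : ℝ} (hp : 0 < p) (hκ : 0 < κ) {k : V → V → ℂ}
    (hk : ∀ z, κ ≤ ‖k z o‖) (h : IsBoundedOnLp X q o α p k a b) : -(p * a) < α - 1 := by
  classical
  set T := hTree.toRegularRootedTree hReg o
  have hq := RegularRootedTree.cast_pos q
  have hw := weight_pos X q o
  obtain ⟨C, hC⟩ := h
  have h1 := (memLp_expMeasure_iff X q o α hp _).1 (hC _ (memLp_single α hp o)).2.1
  have h2 : Summable fun x => κ ^ p * (q : ℝ) ^ ((-α - a * p) * (T.level x : ℝ)) := by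
    refine Summable.of_nonneg_of_le (fun x => by positivity) (fun x => ?_) h1
    rw [norm_weightedOp_single]
    have h3 : weight X q o b o = 1 := by rw [weight, X.dist_self]; simp
    have h4 : (q : ℝ) ^ ((-α - a * p) * (T.level x : ℝ)) =
        weight X q o α x * weight X q o a x ^ p := by
      rw [weight, weight, ← Real.rpow_mul hq.le, ← Real.rpow_add hq]
      change (q : ℝ) ^ ((-α - a * p) * (X.dist o x : ℝ)) = _
      congr 1; ring
    rw [h3, mul_one, h4, mul_left_comm, ← Real.mul_rpow hκ.le (hw a x).le, mul_comm κ]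
    have := hw a x
    have := hw α x
    gcongr
    exact hk x
  rw [summable_mul_left_iff (by positivity), T.summable_comp_level_iff
    (φ := fun n : ℕ => (q : ℝ) ^ ((-α - a * p) * (n : ℝ))) fun n => by positivity,
    RegularRootedTree.summable_pow_mul_rpow_iff] at h2
  linarith

theorem lt_of_isBoundedOnLp_row (hTree : X.IsTree)
    (hReg : X.IsRegularOfDegree (q + 1)) {α p a b κ : ℝ} (hp : 1 < p) (hκ : 0 < κ) {k : V → V → ℂ}
    (hk : ∀ x, κ ≤ ‖k o x‖) (h : IsBoundedOnLp X q o α p k a b) : α - 1 < p * (b - 1) := by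
  set T := hTree.toRegularRootedTree hReg o
  have hq := RegularRootedTree.cast_pos q
  have hp0 : 0 < p := by linarith
  have hw := weight_pos X q o
  by_contra hcon
  obtain ⟨C, hC⟩ := h
  set t := (α - 1) / p with ht
  have htp : t * p = α - 1 := div_mul_cancel₀ _ hp0.ne'
  -- The function `q^(t|x|) / (|x| + 1)` is critical: its `p`-th powers sum like `∑ 1/(n+1)^p`,
  -- which converges for `p > 1`, whereas by this inequality the series at `z = o` dominates a
  -- multiple of the harmonic series.
  have htb : b - 1 ≤ t := by rw [ht, le_div_iff₀ hp0]; linarith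
  set φ : ℕ → ℝ := fun n => (q : ℝ) ^ (t * (n : ℝ)) / ((n : ℝ) + 1) with hφ
  have hφ0 : ∀ n, 0 < φ n := fun n => by positivity
  have hnorm : ∀ x, ‖((φ (T.level x) : ℝ) : ℂ)‖ = φ (T.level x) := fun x => by
    rw [Complex.norm_real, Real.norm_of_nonneg (hφ0 _).le]
  have hmem : MemLp (fun x => ((φ (T.level x) : ℝ) : ℂ)) (ENNReal.ofReal p)
      (expMeasure X q o α) := by
    rw [memLp_expMeasure_iff X q o α hp0]
    simp only [hnorm]
    refine (T.summable_comp_level_iff (φ := fun n : ℕ => (q : ℝ) ^ (-α * (n : ℝ)) * φ n ^ p)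
      fun n => by have := hφ0 n; positivity).2 ?_
    have h1 : Summable fun n : ℕ => 1 / ((n : ℝ) + 1) ^ p := by
      have := (summable_nat_add_iff 1).2 (Real.summable_one_div_nat_rpow.2 hp)
      simpa using this
    refine h1.congr fun n => ?_
    rw [hφ, Real.div_rpow (by positivity) (by positivity), ← Real.rpow_mul hq.le, mul_div_assoc',
      mul_div_assoc', ← Real.rpow_natCast, ← Real.rpow_add hq, ← Real.rpow_add hq]
    have h2 : (n : ℝ) + (-α * n + t * n * p) = 0 := by linear_combination (n : ℝ) * htp
    rw [h2, Real.rpow_zero]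
  have h1 := ((hC _ hmem).1 o).norm
  have h2 : Summable fun x => κ * (φ (T.level x) * (q : ℝ) ^ (-b * (T.level x : ℝ))) := by
    refine Summable.of_nonneg_of_le (fun x => ?_) (fun x => ?_) h1
    · have := hφ0 (T.level x); positivity
    · rw [norm_mul, norm_mul, hnorm, Complex.norm_real, Real.norm_of_nonneg (hw b x).le, mul_assoc]
      exact mul_le_mul_of_nonneg_right (hk x) (mul_nonneg (hφ0 _).le (hw b x).le)
  rw [summable_mul_left_iff hκ.ne', T.summable_comp_level_iff
    (φ := fun n : ℕ => φ n * (q : ℝ) ^ (-b * (n : ℝ)))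
    fun n => by have := hφ0 n; positivity] at h2
  refine Real.not_summable_one_div_natCast ((summable_nat_add_iff 1).1
    (Summable.of_nonneg_of_le (fun n => by positivity) (fun n => ?_) h2))
  have h3 : (q : ℝ) ^ n * (φ n * (q : ℝ) ^ (-b * (n : ℝ))) =
      (q : ℝ) ^ ((1 + t - b) * (n : ℝ)) / ((n : ℝ) + 1) := by
    have h4 : (1 + t - b) * (n : ℝ) = n + (t * n + -b * n) := by ring
    rw [h4, Real.rpow_add hq, Real.rpow_add hq, Real.rpow_natCast, hφ]
    ring
  rw [h3]
  push_cast
  gcongr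
  refine Real.one_le_rpow (by have := RegularRootedTree.two_le_cast q; linarith)
    (mul_nonneg (by linarith) (Nat.cast_nonneg _))

/-- Otherwise the weighted diagonal would grow at least like `q^((c-a-b)|x|)`, which is unbounded
because every level of the tree is inhabited. -/
theorem le_of_isBoundedOnLp_diag (hTree : X.IsTree)
    (hReg : X.IsRegularOfDegree (q + 1)) {α p a b c κ : ℝ} (hp : 0 < p) (hκ : 0 < κ) {k : V → V → ℂ}
    (hk : ∀ x, κ * weight X q o (-c) x ≤ ‖k x x‖) (h : IsBoundedOnLp X q o α p k a b) :
    c ≤ a + b := by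
  set T := hTree.toRegularRootedTree hReg o
  have hq := RegularRootedTree.cast_pos q
  have hw := weight_pos X q o
  by_contra! hcon
  obtain ⟨C, hC⟩ := h.exists_diag_le hp
  have hlt : 1 < (q : ℝ) ^ (c - a - b) :=
    Real.one_lt_rpow (by have := RegularRootedTree.two_le_cast q; linarith) (by linarith)
  obtain ⟨n, hn⟩ := pow_unbounded_of_one_lt (C / κ) hlt
  obtain ⟨x, hx⟩ : (T.desc n T.root).Nonempty := by
    rw [← Finset.card_pos]
    exact lt_of_lt_of_le (pow_pos (by exact_mod_cast hq) n) (T.pow_le_card_desc _ n)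
  have hl : X.dist o x = n := by
    have := T.level_of_mem_desc hx
    rw [T.level_root, zero_add] at this
    exact this
  rw [div_lt_iff₀ hκ] at hn
  refine (hn.trans_le (le_trans ?_ (hC x))).false
  have h1 : ((q : ℝ) ^ (c - a - b)) ^ n =
      weight X q o a x * weight X q o (-c) x * weight X q o b x := by
    rw [weight, weight, weight, hl, ← Real.rpow_natCast, ← Real.rpow_mul hq.le, ← Real.rpow_add hq,
      ← Real.rpow_add hq]
    congr 1; ring
  rw [h1]
  have := hw a x
  have := hw b x
  calc weight X q o a x * weight X q o (-c) x * weight X q o b x * κ =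
      weight X q o a x * (κ * weight X q o (-c) x) * weight X q o b x := by ring
    _ ≤ _ := by gcongr; exact hk x

end HarmonicBergman

theorem mainTheorem4 {V : Type*} [MeasurableSpace V] [DiscreteMeasurableSpace V]
    (X : SimpleGraph V) [X.LocallyFinite] (hTree : X.IsTree)
    (q : ℕ) [q.AtLeastTwo] (hReg : X.IsRegularOfDegree (q + 1)) (o : V)
    (α p a b c : ℝ) (hα : 1 < α) (hc : 1 < c) (hp : 1 < p) :
    List.TFAE
      [HarmonicBergman.SIsBounded X q o α p a b c,
       HarmonicBergman.TIsBounded X q o α p a b c,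
       c ≤ a + b ∧ -(p * a) < α - 1 ∧ α - 1 < p * (b - 1)] := by
  tfae_have 1 → 2 := fun h => h.of_norm
  tfae_have 2 → 3 := fun h => by
    obtain ⟨C, κ, -, hκ, -, hdiag, hrow, hcol⟩ :=
      HarmonicBergman.exists_norm_bergmanKernel_bounds hTree hReg o hc
    have hp0 : 0 < p := by linarith
    exact ⟨HarmonicBergman.le_of_isBoundedOnLp_diag o hTree hReg hp0 hκ hdiag h,
      HarmonicBergman.lt_of_isBoundedOnLp_column o hTree hReg hp0 hκ hcol h,
      HarmonicBergman.lt_of_isBoundedOnLp_row o hTree hReg hp hκ hrow h⟩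
  tfae_have 3 → 1 := fun ⟨h1, h2, h3⟩ =>
    HarmonicBergman.sIsBounded o hTree hReg hc hp h1 h2 h3
  tfae_finish
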